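/- Let $N\ge 1$, let $N=n_1+\dots+n_r$ with all $n_s\ge1$, and let $\lambda_1,\dots,\lambda_N\in\mathbb C$ be numbered so that the consecutive blocks $\{1,\dots,n_1\},\{n_1+1,\dots,n_1+n_2\},\dots$ of indices are exactly the congruence classes mod $\mathbb Z$ of the numbers $\lambda_j/N$ (that is, $(\lambda_i-\lambda_j)/N\in\mathbb Z$ if and only if $i,j$ lie in the same block), and so that $\Re(\lambda_j)$ is nonincreasing in $j$ within each block. For $B\subseteq\{1,\dots,N\}$ with $\#B=\ell\geq 1$ and $x\in\mathbb C\setminus\{0\}$, with a chosen value of $\ln x$ and $x^\omega=e^{\omega\ln x}$, Meijer's function $G^{\ell,0}_{0,N}$ with the parameters $\lambda_i/N$, $i\in B$, in front of the semicolon and $\lambda_i/N$, $i\notin B$, behind it is $$G_{0,N}^{\ell,0}\left(\left.\left\{\tfrac{\lambda_i}N\right\}_{i\in B};\left\{\tfrac{\lambda_i}N\right\}_{i\notin B}\,\right|\,x\right)=-\sum_{\omega_0}\operatorname{Res}_{\omega=\omega_0}\left(\frac{\prod_{i\in B}\Gamma(\frac{\lambda_i}N-\omega)}{\prod_{i\notin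 B}\Gamma(1-\frac{\lambda_i}N+\omega)}\,x^\omega\right),$$ where $\omega_0$ runs through the set of points $\frac{\lambda_i}N+n$, $i\in B$, $n=0,1,2,\dots$. For $1\le j\le N$ let $B_j$ be the set of indices from the beginning of the block of $j$ up to and including $j$, let $\ell_j=\#B_j$ be the position of $j$ in its block, and put $$\eta_j(\zeta)=G_{0,N}^{\ell_j,0}\left(\left.\left\{\tfrac{\lambda_i}N\right\}_{i\in B_j};\left\{\tfrac{\lambda_i}N\right\}_{i\notin B_j}\,\right|\,(-1)^{\ell_j}\zeta\right),\qquad \zeta\in\mathbb C\setminus\{0\}.$$ Then the following hold. (i) The sums of residues defining the $\eta_j$ converge absolutely for every $\zeta\in\mathbb C\setminus\{0\}$ and every value of the logarithm; and if $j$ is the first index of its block ($\ell_j=1$), then, with the same value of $\ln(-\zeta)$ on both sides, $$\eta_j(\zeta)=\frac{(-\zeta)^{\lambda_j/N}}{\prod_{i=1}^N\Gamma\left(1+\frac{\lambda_j-\lambda_i}N\right)}\;{}_0F_{N-1}\left(\left.\left\{1+\tfrac{\lambda_j-\lambda_i}N\right\}_{i\ne j}\,\right|\,\zeta\right),$$ where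 ${}_0F_{s}(\beta_1,\dots,\beta_s\,|\,\zeta)=\sum_{k\ge0}\frac{1}{(\beta_1)_k\cdots(\beta_s)_k}\frac{\zeta^k}{k!}$ and $(\beta)_k=\beta(\beta+1)\cdots(\beta+k-1)$. (ii) $\eta_1,\dots,\eta_N$ is a fundamental system of solutions of $$\Big[\prod_{j=1}^N\Big(\zeta\frac{d}{d\zeta}-\frac{\lambda_j}N\Big)-\zeta\Big]\eta(\zeta)=0,\qquad \zeta\in\mathbb C\setminus\{0\}.$$ (iii) For every $\mu\in\mathbb C\setminus\{0\}$, the functions $y_j(\mu,z)=\eta_j(\mu(z/N)^N)$, $1\le j\le N$, form a fundamental system of solutions of the generalized Euler eigenvalue equation $$z^{-N}\prod_{j=1}^N\Big[z\frac{d}{dz}-\lambda_j\Big]\,y(\mu,z)=\mu\,y(\mu,z),\qquad z\in\mathbb C\setminus\{0\}.$$ Since these functions are in general multivalued, (ii) and (iii) are understood as follows: on every nonempty connected open set $U\subseteq\mathbb C\setminus\{0\}$, and for every choice, for each $j$, of a holomorphic branch on $U$ of $\ln((-1)^{\ell_j}\zeta)$, respectively of $\ln((-1)^{\ell_j}\mu(z/N)^N)$,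 the resulting $N$ functions are holomorphic solutions on $U$, are linearly independent on $U$, and every holomorphic solution on $U$ is a linear combination of them. -/

import Mathlib

open Filter Topology

noncomputable section

namespace EulerMeijer

/-- The residue of `f` at an isolated singularity `a`: the value of
`(2πi)⁻¹ ∮ f` over all sufficiently small positively oriented circles around `a`. -/
def residue (f : ℂ → ℂ) (a : ℂ) : ℂ :=
  limUnder (𝓝[>] (0 : ℝ)) fun ρ : ℝ =>
    (2 * (Real.pi : ℂ) * Complex.I)⁻¹ * ∮ ω in C(a, ρ), f ω

/-- The integrand of the Mellin-type integral of `G_{p,q}^{m,n}`. The index sets `A` and `B` (with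
`n = #A`, `m = #B`) single out the parameters `a_k`, `b_j` written in front of the semicolons.
The variable `x ≠ 0` of the `G`-function enters through a logarithm `w` of `x`, so that
`x ^ ω = exp (ω * w)`. -/
def meijerIntegrand {p q : ℕ} (a : Fin p → ℂ) (A : Finset (Fin p)) (b : Fin q → ℂ)
    (B : Finset (Fin q)) (w ω : ℂ) : ℂ :=
  ((∏ j ∈ B, Complex.Gamma (b j - ω)) * ∏ k ∈ A, Complex.Gamma (1 - a k + ω)) /
    ((∏ j ∈ Bᶜ, Complex.Gamma (1 - b j + ω)) * ∏ k ∈ Aᶜ, Complex.Gamma (a k - ω)) *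
    Complex.exp (ω * w)

/-- The points `b_j + n`, `j ∈ B`, `n = 0, 1, 2, …`: the poles of the functions `Γ(b_j - ·)`. -/
def meijerPoles {q : ℕ} (b : Fin q → ℂ) (B : Finset (Fin q)) : Set ℂ :=
  {ω | ∃ j ∈ B, ∃ n : ℕ, ω = b j + n}

/-- Meijer's function `G_{p,q}^{m,n}` (`n = #A`, `m = #B`, `p < q`) at the point `x = exp w`, on the
branch given by `log x = w`: the sum of the residues of the integrand at the poles of the
`Γ(b_j - ·)`, `j ∈ B`, with a minus sign since the contour is negatively oriented. -/
def meijerG {p q : ℕ} (a : Fin p → ℂ) (A : Finset (Fin p)) (b : Fin q → ℂ)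
    (B : Finset (Fin q)) (w : ℂ) : ℂ :=
  -∑' ω : meijerPoles b B, residue (meijerIntegrand a A b B w) ω

/-- The generalized hypergeometric function `_rF_s`, with finite families of parameters `α`, `β`. -/
def genHypergeometric {ι κ : Type*} [Fintype ι] [Fintype κ] (α : ι → ℂ) (β : κ → ℂ) (ζ : ℂ) : ℂ :=
  ∑' k : ℕ, (∏ i, (ascPochhammer ℂ k).eval (α i)) / (∏ i, (ascPochhammer ℂ k).eval (β i)) *
    (ζ ^ k / (k.factorial : ℂ))

/-- The operator `∏_{j=1}^N (z d/dz - c_j)`. -/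
def eulerProd {N : ℕ} (c : Fin N → ℂ) (f : ℂ → ℂ) : ℂ → ℂ :=
  (List.ofFn c).foldr (fun c g z => z * deriv g z - c * g z) f

/-- The Euler differential expression `τ_N(λ_1, …, λ_N) = z^{-N} ∏_{j=1}^N (z d/dz - λ_j)`. -/
def eulerTau {N : ℕ} (lam : Fin N → ℂ) (y : ℂ → ℂ) (z : ℂ) : ℂ :=
  (z ^ N)⁻¹ * eulerProd lam y z

/-- `y` is a (holomorphic) solution on `U` of `τ_N(λ_1, …, λ_N) y = μ y`. -/
def IsEulerSolution {N : ℕ} (lam : Fin N → ℂ) (μ : ℂ) (U : Set ℂ) (y : ℂ → ℂ) : Prop :=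
  DifferentiableOn ℂ y U ∧ ∀ z ∈ U, eulerTau lam y z = μ * y z

/-- `η` is a (holomorphic) solution on `U` of `[∏_{j=1}^N (ζ d/dζ - b_j) - ζ] η = 0`. -/
def IsMeijerSolution {N : ℕ} (b : Fin N → ℂ) (U : Set ℂ) (η : ℂ → ℂ) : Prop :=
  DifferentiableOn ℂ η U ∧ ∀ ζ ∈ U, eulerProd b η ζ - ζ * η ζ = 0

/-- The functions `u j` form, on `U`, a fundamental system for the linear differential equation
whose solutions on `U` are described by `Sol`: they are solutions, they are linearly independent on
`U`, and every solution is on `U` a linear combination of them. -/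
def IsFundamentalSystem {N : ℕ} (U : Set ℂ) (Sol : (ℂ → ℂ) → Prop) (u : Fin N → ℂ → ℂ) : Prop :=
  (∀ j, Sol (u j)) ∧ LinearIndependent ℂ (fun j (z : U) => u j z) ∧
    ∀ f, Sol f → ∃ c : Fin N → ℂ, ∀ z ∈ U, f z = ∑ j, c j * u j z

/-- A domain in the punctured plane: a nonempty, open, connected subset of `ℂ \ {0}`. -/
def IsPuncturedDomain (U : Set ℂ) : Prop := IsOpen U ∧ IsConnected U ∧ (0 : ℂ) ∉ U

/-- `L` is a holomorphic branch on `U` of `log f`. -/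
def IsLogBranch (U : Set ℂ) (f L : ℂ → ℂ) : Prop :=
  DifferentiableOn ℂ L U ∧ ∀ z ∈ U, Complex.exp (L z) = f z

/-- The consecutive blocks `{1, …, n_1}, {n_1 + 1, …, n_1 + n_2}, …` of the composition
`N = n_1 + ⋯ + n_r` are the congruence classes mod `ℤ` of the `λ_j / N`, and within each block the
real parts of the `λ_j` are nonincreasing. -/
def IsCongruenceGrouping {N : ℕ} (lam : Fin N → ℂ) (c : Composition N) : Prop :=
  (∀ i j, c.index i = c.index j ↔ ∃ k : ℤ, (lam i - lam j) / N = k) ∧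
    ∀ i j, c.index i = c.index j → i ≤ j → (lam j).re ≤ (lam i).re

/-- The indices from the beginning of the block of `j` up to and including `j`. -/
def blockPrefix {N : ℕ} (c : Composition N) (j : Fin N) : Finset (Fin N) :=
  {i | c.index i = c.index j ∧ i ≤ j}

/-- The position `ℓ` of `j` in its block, counted from `1`. -/
def blockPos {N : ℕ} (c : Composition N) (j : Fin N) : ℕ := (blockPrefix c j).card

/-- With `ℓ = blockPos c j`: the function `G_{0,N}^{ℓ,0}` whose parameters in front of the semicolon
are the first `ℓ` of the `λ_i / N` in the block of `j`, and whose other parameters are all the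
remaining `λ_i / N`, evaluated at `exp w` on the branch given by `w`. -/
def blockG {N : ℕ} (lam : Fin N → ℂ) (c : Composition N) (j : Fin N) (w : ℂ) : ℂ :=
  meijerG (p := 0) ![] ∅ (fun i => lam i / N) (blockPrefix c j) w

end EulerMeijer

end

/-! ### Products of first-order operators: logarithmic substitution and dimension of the solution
space. -/

namespace EulerMeijer

/-! In the variable `w = log x` the functions become entire: `G(w) = -(2πi)⁻¹ ∑ₙ ∮ K(ω) e^{ωw} dω`
over circles about `β + n`, where `K` is `gammaKernel`, and `z d/dz` becomes a multiple of `d/dw`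
(`eulerList_comp`). The functional equation of Γ gives `K(ω - 1) = (-1)^ℓ ∏ (ω - b_i) K(ω)`
(`gammaKernel_sub_one`). This one recurrence yields the superexponential decay of `K(ω + n)`, hence
convergence, and also the differential equation: `∏ (d/dw - b_i)` moves every circle one step to the
left and brings out `(-1)^ℓ e^w` (`PolesIn.derivList_poleSum`).

Independence comes from monodromy. Let `M` be the translation by `2πi`. By the reflection formula,
`M - e^{2πi b_j}` removes `b_j` from the front parameters, up to a nonzero constant and a
translation by `πi` (`PolesIn.monodromy_poleSum`). Hence the function at position `ℓ` of a block is
a generalized eigenvector of exact rank `ℓ`: the chain ends at the first function of the block,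
whose leading coefficient `∏ 1/Γ(1 + b_j - b_i)` is nonzero. Different blocks have different
eigenvalues, and linear algebra does the rest (`linearIndependent_of_genEigenvectors`). Translations
commute with `M`, so the logarithms may be chosen independently of each other.

For spanning, a solution is determined by `N` quasi-derivatives at one point
(`eqOn_zero_of_eulerList`), so `N` independent solutions suffice (`exists_eq_sum_of_solutions`). -/

/-- The operator `∏_{c ∈ l} (z d/dz - c)`. -/
noncomputable def eulerList (l : List ℂ) (f : ℂ → ℂ) : ℂ → ℂ :=
  l.foldr (fun c g z => z * deriv g z - c * g z) f

/-- The operator `∏_{c ∈ l} (d/dw - c)`. -/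
noncomputable def derivList (l : List ℂ) (f : ℂ → ℂ) : ℂ → ℂ :=
  l.foldr (fun c g w => deriv g w - c * g w) f

theorem eulerList_cons (c : ℂ) (l : List ℂ) (f : ℂ → ℂ) (z : ℂ) :
    eulerList (c :: l) f z = z * deriv (eulerList l f) z - c * eulerList l f z := rfl

theorem derivList_cons (c : ℂ) (l : List ℂ) (f : ℂ → ℂ) (w : ℂ) :
    derivList (c :: l) f w = deriv (derivList l f) w - c * derivList l f w := rfl

theorem differentiableOn_eulerList {U : Set ℂ} (hU : IsOpen U) {f : ℂ → ℂ}
    (hf : DifferentiableOn ℂ f U) (l : List ℂ) : DifferentiableOn ℂ (eulerList l f) U := by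
  induction l with
  | nil => exact hf
  | cons c l ih =>
    exact (differentiableOn_id.mul (ih.deriv hU)).sub ((differentiableOn_const c).mul ih)

theorem differentiable_derivList {f : ℂ → ℂ} (hf : Differentiable ℂ f) (l : List ℂ) :
    Differentiable ℂ (derivList l f) := by
  induction l with
  | nil => exact hf
  | cons c l ih => exact ih.deriv.sub ((differentiable_const c).mul ih)

theorem eulerList_sum {ι : Type*} {U : Set ℂ} (hU : IsOpen U) (s : Finset ι) (a : ι → ℂ)
    (v : ι → ℂ → ℂ) (hv : ∀ i, DifferentiableOn ℂ (v i) U) (l : List ℂ) :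
    ∀ z ∈ U, eulerList l (fun z => ∑ i ∈ s, a i * v i z) z = ∑ i ∈ s, a i * eulerList l (v i) z := by
  induction l with
  | nil => intro z _; rfl
  | cons c l ih =>
    intro z hz
    have hev : eulerList l (fun z => ∑ i ∈ s, a i * v i z) =ᶠ[𝓝 z]
        fun z => ∑ i ∈ s, a i * eulerList l (v i) z :=
      Filter.eventuallyEq_of_mem (hU.mem_nhds hz) ih
    have hd : ∀ i ∈ s, HasDerivAt (fun z => a i * eulerList l (v i) z)
        (a i * deriv (eulerList l (v i)) z) z := fun i _ =>
      (((differentiableOn_eulerList hU (hv i) l).differentiableAt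
        (hU.mem_nhds hz)).hasDerivAt).const_mul _
    rw [eulerList_cons, hev.deriv_eq, ih z hz, (HasDerivAt.fun_sum hd).deriv, Finset.mul_sum,
      Finset.mul_sum, ← Finset.sum_sub_distrib]
    refine Finset.sum_congr rfl fun i _ => ?_
    rw [eulerList_cons]
    ring

/-- If `z L'(z) = m`, the substitution `w = L(z)` turns `∏ (d/dw - c)` into
`m⁻ᴺ ∏ (z d/dz - m c)`. -/
theorem eulerList_comp {U : Set ℂ} (hU : IsOpen U) {L F : ℂ → ℂ} {m : ℂ}
    (hL : DifferentiableOn ℂ L U) (hLm : ∀ z ∈ U, z * deriv L z = m) (hF : Differentiable ℂ F)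
    (l : List ℂ) :
    ∀ z ∈ U, eulerList (l.map (m * ·)) (fun z => F (L z)) z =
      m ^ l.length * derivList l F (L z) := by
  induction l with
  | nil => intro z _; simp [eulerList, derivList]
  | cons c l ih =>
    intro z hz
    have hev : eulerList (l.map (m * ·)) (fun z => F (L z)) =ᶠ[𝓝 z]
        fun z => m ^ l.length * derivList l F (L z) :=
      Filter.eventuallyEq_of_mem (hU.mem_nhds hz) ih
    have hd : HasDerivAt (fun z => m ^ l.length * derivList l F (L z))
        (m ^ l.length * (deriv (derivList l F) (L z) * deriv L z)) z :=
      ((differentiable_derivList hF l (L z)).hasDerivAt.comp z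
        (hL.differentiableAt (hU.mem_nhds hz)).hasDerivAt).const_mul _
    rw [List.map_cons, eulerList_cons, hev.deriv_eq, hd.deriv, ih z hz, derivList_cons,
      List.length_cons]
    linear_combination (m ^ l.length * deriv (derivList l F) (L z)) * hLm z hz

/-- A solution of `∏ (z d/dz - c) f = q f` whose quasi-derivatives of order less than the order of
the equation vanish at one point is zero. -/
theorem eqOn_zero_of_eulerList {U : Set ℂ} (hU : IsOpen U) (hUc : IsPreconnected U)
    (h0 : (0 : ℂ) ∉ U) {q f : ℂ → ℂ} (hq : DifferentiableOn ℂ q U) (hf : DifferentiableOn ℂ f U)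
    (l : List ℂ) (hsol : ∀ z ∈ U, eulerList l f z = q z * f z) {z₀ : ℂ} (hz₀ : z₀ ∈ U)
    (hjet : ∀ k < l.length, eulerList (l.drop (k + 1)) f z₀ = 0) (hl : l ≠ []) :
    Set.EqOn f 0 U := by
  have han : ∀ k, AnalyticAt ℂ (eulerList (l.drop k) f) z₀ := fun k =>
    (differentiableOn_eulerList hU hf _).analyticAt (hU.mem_nhds hz₀)
  have hlen : 0 < l.length := List.length_pos_iff.2 hl
  -- All quasi-derivatives vanish at `z₀` to every order `m`. If `g` is one of them, `z g'` is a
  -- combination of `g` and the next one (`q * f` at the top), so it has order at least `m`; since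
  -- `z₀ ≠ 0` and `g z₀ = 0`, the order of `g` is at least `m + 1`.
  have key : ∀ m : ℕ, ∀ k < l.length,
      (m : ℕ∞) ≤ analyticOrderAt (eulerList (l.drop (k + 1)) f) z₀ := by
    intro m
    induction m with
    | zero => intro k _; simp
    | succ m ih =>
      intro k hk
      have hprev : (m : ℕ∞) ≤ analyticOrderAt (eulerList (l.drop k) f) z₀ := by
        rcases k with _ | k
        · have h1 : eulerList (l.drop 0) f =ᶠ[𝓝 z₀] q * f :=
            Filter.eventuallyEq_of_mem (hU.mem_nhds hz₀) fun z hz => by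
              simpa using hsol z hz
          rw [analyticOrderAt_congr h1, analyticOrderAt_mul (hq.analyticAt (hU.mem_nhds hz₀))
            (hf.analyticAt (hU.mem_nhds hz₀))]
          have h2 := ih (l.length - 1) (by omega)
          rw [Nat.sub_add_cancel hlen, List.drop_length] at h2
          exact h2.trans le_add_self
        · exact ih k (by omega)
      set g := eulerList (l.drop (k + 1)) f with hg
      have hgan : AnalyticAt ℂ g z₀ := han (k + 1)
      have hfun : (id * deriv g : ℂ → ℂ) = eulerList (l.drop k) f + (fun _ => l[k]) * g := by
        funext z
        rw [Pi.add_apply, List.drop_eq_getElem_cons hk, eulerList_cons]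
        simp only [Pi.mul_apply, id, ← hg]
        ring
      have hord : (m : ℕ∞) ≤ analyticOrderAt (id * deriv g : ℂ → ℂ) z₀ := by
        rw [hfun]
        refine le_trans (le_min hprev ?_) le_analyticOrderAt_add
        rw [analyticOrderAt_mul analyticAt_const hgan]
        exact (ih k hk).trans le_add_self
      have hz0 : z₀ ≠ 0 := fun h => h0 (h ▸ hz₀)
      have hid : analyticOrderAt (id : ℂ → ℂ) z₀ = 0 :=
        (analyticAt_id.analyticOrderAt_eq_zero).2 hz0
      rw [analyticOrderAt_mul analyticAt_id hgan.deriv, hid, zero_add] at hord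
      have h3 := hgan.analyticOrderAt_deriv_add_one
      rw [show g z₀ = 0 from hjet k hk] at h3
      simp only [sub_zero] at h3
      rw [← h3]
      push_cast
      gcongr
  have htop : analyticOrderAt f z₀ = ⊤ := by
    refine ENat.eq_top_iff_forall_ge.2 fun m => ?_
    have h2 := key m (l.length - 1) (by omega)
    rwa [Nat.sub_add_cancel hlen, List.drop_length] at h2
  exact (hf.analyticOnNhd hU).eqOn_zero_of_preconnected_of_eventuallyEq_zero hUc hz₀
    (analyticOrderAt_eq_top.1 htop)

/-- `N` linearly independent solutions of `∏ (z d/dz - c_j) f = q f` span the solution space. -/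
theorem exists_eq_sum_of_solutions {N : ℕ} (hN : 0 < N) {U : Set ℂ} (hU : IsPuncturedDomain U)
    {q : ℂ → ℂ} (hq : DifferentiableOn ℂ q U) (b : Fin N → ℂ) (u : Fin N → ℂ → ℂ)
    (hu : ∀ j, DifferentiableOn ℂ (u j) U) (hus : ∀ j, ∀ z ∈ U, eulerProd b (u j) z = q z * u j z)
    (hli : LinearIndependent ℂ (fun j (z : U) => u j z)) {f : ℂ → ℂ} (hf : DifferentiableOn ℂ f U)
    (hfs : ∀ z ∈ U, eulerProd b f z = q z * f z) :
    ∃ c : Fin N → ℂ, ∀ z ∈ U, f z = ∑ j, c j * u j z := by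
  obtain ⟨hUo, hUc, h0⟩ := hU
  obtain ⟨z₀, hz₀⟩ := hUc.nonempty
  set l := List.ofFn b with hl
  have hlen : l.length = N := List.length_ofFn
  let v : Option (Fin N) → ℂ → ℂ := fun o => o.elim f u
  have hv : ∀ o, DifferentiableOn ℂ (v o) U := by
    rintro (_ | j)
    exacts [hf, hu j]
  have hvs : ∀ o, ∀ z ∈ U, eulerList l (v o) z = q z * v o z := by
    rintro (_ | j)
    exacts [hfs, hus j]
  -- Together with `f` there are `N + 1` solutions, but their jets at `z₀` lie in an `N`-dimensional
  -- space.
  have hdep : ¬ LinearIndependent ℂ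
      (fun o (k : Fin N) => eulerList (l.drop (k + 1)) (v o) z₀) := by
    intro h
    have := h.fintype_card_le_finrank
    simp at this
  obtain ⟨a, ha, o₁, ho₁⟩ := Fintype.not_linearIndependent_iff.1 hdep
  have hzero : Set.EqOn (fun z => ∑ o, a o * v o z) 0 U := by
    refine eqOn_zero_of_eulerList hUo hUc.isPreconnected h0 hq ?_ l ?_ hz₀ ?_ ?_
    · exact DifferentiableOn.fun_sum fun o _ => (differentiableOn_const _).mul (hv o)
    · intro z hz
      rw [eulerList_sum hUo _ _ _ hv l z hz, Finset.mul_sum]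
      refine Finset.sum_congr rfl fun o _ => ?_
      rw [hvs o z hz]
      ring
    · intro k hk
      rw [eulerList_sum hUo _ _ _ hv _ z₀ hz₀]
      have := congrFun ha ⟨k, hlen ▸ hk⟩
      simpa using this
    · intro h
      rw [h] at hlen
      simp at hlen
      omega
  have hne : a none ≠ 0 := by
    intro hnone
    have h1 : ∑ j, a (some j) • (fun (z : U) => u j z) = 0 := by
      funext z
      have := hzero z.2
      simpa [Fintype.sum_option, hnone, v] using this
    have h2 := Fintype.linearIndependent_iff.1 hli _ h1
    rcases o₁ with _ | j
    exacts [ho₁ hnone, ho₁ (h2 j)]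
  refine ⟨fun j => -(a none)⁻¹ * a (some j), fun z hz => ?_⟩
  have h1 : a none * f z + ∑ j, a (some j) * u j z = 0 := by
    have := hzero hz
    simpa [Fintype.sum_option, v] using this
  have h2 : ∑ j, -(a none)⁻¹ * a (some j) * u j z = -(a none)⁻¹ * ∑ j, a (some j) * u j z := by
    rw [Finset.mul_sum]
    exact Finset.sum_congr rfl fun j _ => by ring
  rw [h2, eq_neg_of_add_eq_zero_right h1]
  field_simp

/-! ### Linear algebra of generalized eigenvectors. -/

open Polynomial in
/-- Generalized eigenvectors of exact ranks `r i + 1` are linearly independent if those for the same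
eigenvalue have different ranks. -/
theorem linearIndependent_of_genEigenvectors {K E ι : Type*} [Field K] [AddCommGroup E]
    [Module K E] [Fintype ι] (T : Module.End K E) (α : ι → K) (r : ι → ℕ) (v : ι → E)
    (hinj : ∀ i j, α i = α j → r i = r j → i = j)
    (hzero : ∀ i, ((T - algebraMap K _ (α i)) ^ (r i + 1)) (v i) = 0)
    (hne : ∀ i, ((T - algebraMap K _ (α i)) ^ r i) (v i) ≠ 0) : LinearIndependent K v := by
  classical
  rw [Fintype.linearIndependent_iff]
  intro a ha
  by_contra! hcon
  obtain ⟨i₀, hi₀⟩ := hcon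
  obtain ⟨i₁, hi₁, hmax⟩ := Finset.exists_max_image
    (Finset.univ.filter fun i => α i = α i₀ ∧ a i ≠ 0) r ⟨i₀, by simp [hi₀]⟩
  simp only [Finset.mem_filter, Finset.mem_univ, true_and] at hi₁ hmax
  -- `p` kills the vectors with other eigenvalues, and `(X - α)^(r i₁)` kills those of smaller rank
  -- with the same eigenvalue, so applying both to the relation isolates `v i₁`.
  let p : K[X] := ∏ i ∈ Finset.univ.filter (fun i => α i ≠ α i₀), (X - C (α i)) ^ (r i + 1)
  have hX : ∀ i, aeval T (X - C (α i)) = T - algebraMap K _ (α i) := fun i => by simp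
  have hkill : ∀ i, i ≠ i₁ → a i • aeval T (p * (X - C (α i₁)) ^ r i₁) (v i) = 0 := by
    intro i hi
    by_cases hai : a i = 0
    · simp [hai]
    suffices h : (X - C (α i)) ^ (r i + 1) ∣ p * (X - C (α i₁)) ^ r i₁ by
      obtain ⟨s, hs⟩ := h
      rw [hs, mul_comm, map_mul, map_pow, hX, Module.End.mul_apply, hzero, map_zero, smul_zero]
    by_cases hα : α i = α i₀
    · have hlt : r i < r i₁ := lt_of_le_of_ne (hmax i ⟨hα, hai⟩) fun h =>
        hi (hinj i i₁ (hα.trans hi₁.1.symm) h)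
      rw [hα, ← hi₁.1]
      exact (pow_dvd_pow _ hlt).mul_left _
    · have hmem : i ∈ Finset.univ.filter (fun i => α i ≠ α i₀) := by simpa using hα
      exact (Finset.dvd_prod_of_mem (fun i => (X - C (α i)) ^ (r i + 1)) hmem).mul_right _
  have hsum : a i₁ • aeval T (p * (X - C (α i₁)) ^ r i₁) (v i₁) = 0 := by
    generalize aeval T (p * (X - C (α i₁)) ^ r i₁) = Q at hkill
    rw [← Finset.sum_eq_single (f := fun i => a i • Q (v i)) i₁ (fun i _ hi => hkill i hi)
      (fun h => absurd (Finset.mem_univ _) h)]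
    simpa only [map_sum, map_smul, map_zero] using congrArg Q ha
  -- What remains of `v i₁` is a true eigenvector, on which `p` acts by the nonzero scalar `p(α
  -- i₁)`.
  have hev : T.HasEigenvector (α i₁) (((T - algebraMap K _ (α i₁)) ^ r i₁) (v i₁)) := by
    refine ⟨?_, hne i₁⟩
    have := hzero i₁
    rw [pow_succ', Module.End.mul_apply, LinearMap.sub_apply, sub_eq_zero] at this
    rw [Module.End.mem_eigenspace_iff, this, Module.algebraMap_end_apply]
  rw [map_mul, Module.End.mul_apply, map_pow, hX, Module.End.aeval_apply_of_hasEigenvector hev,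
    smul_eq_zero, smul_eq_zero] at hsum
  rcases hsum with h | h | h
  · exact hi₁.2 h
  · simp only [p, eval_prod, Finset.prod_eq_zero_iff, eval_pow, eval_sub, eval_X, eval_C] at h
    obtain ⟨i, hi, h⟩ := h
    have h' := sub_eq_zero.1 (pow_eq_zero_iff (Nat.succ_ne_zero _) |>.1 h)
    simp only [Finset.mem_filter, Finset.mem_univ, true_and] at hi
    exact hi (h'.symm.trans hi₁.1)
  · exact hne i₁ h

end EulerMeijer

namespace EulerMeijer

open Metric Complex

/-! ### Series of entire functions -/

/-- A sequence of entire functions that is normally summable on bounded sets. -/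
structure IsNormallySummable (f : ℕ → ℂ → ℂ) : Prop where
  differentiable : ∀ n, Differentiable ℂ (f n)
  bound : ∀ R : ℝ, ∃ u : ℕ → ℝ, Summable u ∧ ∀ n w, ‖w‖ ≤ R → ‖f n w‖ ≤ u n

namespace IsNormallySummable

variable {f g : ℕ → ℂ → ℂ}

theorem summable_norm (hf : IsNormallySummable f) (w : ℂ) : Summable fun n => ‖f n w‖ := by
  obtain ⟨u, hu, h⟩ := hf.bound ‖w‖
  exact Summable.of_nonneg_of_le (fun _ => norm_nonneg _) (fun n => h n w le_rfl) hu

theorem summable (hf : IsNormallySummable f) (w : ℂ) : Summable fun n => f n w :=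
  (hf.summable_norm w).of_norm

theorem differentiable_tsum (hf : IsNormallySummable f) :
    Differentiable ℂ fun w => ∑' n, f n w := by
  intro w
  obtain ⟨u, hu, h⟩ := hf.bound (‖w‖ + 1)
  refine (Complex.differentiableOn_tsum_of_summable_norm hu
    (fun n => (hf.differentiable n).differentiableOn) (isOpen_ball (x := (0 : ℂ)) (ε := ‖w‖ + 1))
    fun n z hz => h n z ?_).differentiableAt (isOpen_ball.mem_nhds ?_)
  · exact (mem_ball_zero_iff.1 hz).le
  · simp

theorem deriv_tsum (hf : IsNormallySummable f) (w : ℂ) :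
    deriv (fun w => ∑' n, f n w) w = ∑' n, deriv (f n) w := by
  obtain ⟨u, hu, h⟩ := hf.bound (‖w‖ + 1)
  refine (Complex.hasSum_deriv_of_summable_norm hu
    (fun n => (hf.differentiable n).differentiableOn) (isOpen_ball (x := (0 : ℂ)) (ε := ‖w‖ + 1))
    (fun n z hz => h n z ?_) ?_).tsum_eq.symm
  · exact (mem_ball_zero_iff.1 hz).le
  · simp

/-- Cauchy's estimate on unit circles: the majorant for radius `R + 1` bounds the derivatives on
radius `R`. -/
theorem deriv (hf : IsNormallySummable f) : IsNormallySummable fun n => deriv (f n) := by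
  refine ⟨fun n => (hf.differentiable n).deriv, fun R => ?_⟩
  obtain ⟨u, hu, h⟩ := hf.bound (R + 1)
  refine ⟨u, hu, fun n w hw => ?_⟩
  have := Complex.norm_deriv_le_of_forall_mem_sphere_norm_le (c := w) (C := u n) one_pos
    (hf.differentiable n).diffContOnCl fun z hz => h n z ?_
  · simpa using this
  · calc ‖z‖ = ‖w + (z - w)‖ := by ring_nf
      _ ≤ ‖w‖ + ‖z - w‖ := norm_add_le _ _
      _ ≤ R + 1 := add_le_add hw (mem_sphere_iff_norm.1 hz).le

theorem sub (hf : IsNormallySummable f) (hg : IsNormallySummable g) :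
    IsNormallySummable fun n w => f n w - g n w := by
  refine ⟨fun n => (hf.differentiable n).sub (hg.differentiable n), fun R => ?_⟩
  obtain ⟨u, hu, h⟩ := hf.bound R
  obtain ⟨u', hu', h'⟩ := hg.bound R
  exact ⟨_, hu.add hu', fun n w hw => (norm_sub_le _ _).trans (add_le_add (h n w hw) (h' n w hw))⟩

theorem const_mul (hf : IsNormallySummable f) (c : ℂ) :
    IsNormallySummable fun n w => c * f n w := by
  refine ⟨fun n => (hf.differentiable n).const_mul c, fun R => ?_⟩
  obtain ⟨u, hu, h⟩ := hf.bound R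
  exact ⟨_, hu.mul_left ‖c‖, fun n w hw => by
    rw [norm_mul]; exact mul_le_mul_of_nonneg_left (h n w hw) (norm_nonneg _)⟩

theorem derivList (hf : IsNormallySummable f) (l : List ℂ) :
    IsNormallySummable fun n => derivList l (f n) := by
  induction l with
  | nil => exact hf
  | cons c l ih => exact ih.deriv.sub (ih.const_mul c)

theorem derivList_tsum (hf : IsNormallySummable f) (l : List ℂ) :
    EulerMeijer.derivList l (fun w => ∑' n, f n w) =
      fun w => ∑' n, EulerMeijer.derivList l (f n) w := by
  induction l with
  | nil => rfl
  | cons c l ih =>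
    funext w
    have h := hf.derivList l
    rw [derivList_cons, ih, h.deriv_tsum, ← tsum_mul_left,
      ← (h.deriv.summable w).tsum_sub ((h.const_mul c).summable w)]
    rfl

end IsNormallySummable

/-! ### Circle integrals of exponentials -/

theorem hasDerivAt_circleIntegral_mul_exp {g : ℂ → ℂ} {a : ℂ} {R : ℝ} (hR : 0 ≤ R)
    (hg : ContinuousOn g (sphere a R)) (w : ℂ) :
    HasDerivAt (fun w => ∮ ω in C(a, R), g ω * exp (ω * w))
      (∮ ω in C(a, R), ω * g ω * exp (ω * w)) w := by
  have hgc : Continuous fun θ => g (circleMap a R θ) :=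
    hg.comp_continuous (continuous_circleMap a R) fun θ => circleMap_mem_sphere a hR θ
  have hc : Continuous (circleMap a R) := continuous_circleMap a R
  have hc' : Continuous (circleMap 0 R) := continuous_circleMap 0 R
  have hF : ∀ x : ℂ, Continuous fun θ : ℝ =>
      _root_.deriv (circleMap a R) θ • (g (circleMap a R θ) * exp (circleMap a R θ * x)) := by
    intro x
    simp only [deriv_circleMap]
    exact (hc'.mul continuous_const).smul (hgc.mul (hc.mul continuous_const).cexp)
  have hF' : ∀ x : ℂ, Continuous fun θ : ℝ =>
      _root_.deriv (circleMap a R) θ •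
        (circleMap a R θ * g (circleMap a R θ) * exp (circleMap a R θ * x)) := by
    intro x
    simp only [deriv_circleMap]
    exact (hc'.mul continuous_const).smul ((hc.mul hgc).mul (hc.mul continuous_const).cexp)
  refine (intervalIntegral.hasDerivAt_integral_of_dominated_loc_of_deriv_le
    (F' := fun x θ => _root_.deriv (circleMap a R) θ •
        (circleMap a R θ * g (circleMap a R θ) * exp (circleMap a R θ * x)))
    (bound := fun θ => ‖_root_.deriv (circleMap a R) θ‖ *
        (‖circleMap a R θ * g (circleMap a R θ)‖ * Real.exp (‖circleMap a R θ‖ * (‖w‖ + 1))))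
    (ball_mem_nhds w one_pos) (Eventually.of_forall fun x => (hF x).aestronglyMeasurable)
    ((hF w).intervalIntegrable _ _) (hF' w).aestronglyMeasurable ?_ ?_ ?_).2
  · refine Eventually.of_forall fun θ _ x hx => ?_
    rw [norm_smul, norm_mul]
    gcongr
    refine (norm_exp_le_exp_norm _).trans (Real.exp_le_exp.2 ?_)
    rw [norm_mul]
    gcongr
    calc ‖x‖ = ‖w + (x - w)‖ := by ring_nf
      _ ≤ ‖w‖ + ‖x - w‖ := norm_add_le _ _
      _ ≤ ‖w‖ + 1 := by gcongr; exact (mem_ball_iff_norm.1 hx).le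
  · refine Continuous.intervalIntegrable ?_ _ _
    simp only [deriv_circleMap]
    exact (hc'.mul continuous_const).norm.mul
      ((hc.mul hgc).norm.mul (Real.continuous_exp.comp (hc.norm.mul continuous_const)))
  · refine Eventually.of_forall fun θ _ x _ => ?_
    have h := ((((hasDerivAt_id x).const_mul (circleMap a R θ)).cexp).const_mul
      (g (circleMap a R θ))).const_smul (_root_.deriv (circleMap a R) θ)
    refine h.congr_deriv ?_
    simp only [id, smul_eq_mul]
    ring

/-- On `exp (ω * w)` the factor `d/dw - c` is multiplication by `ω - c`, so the operator becomes a
polynomial weight on the contour. -/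
theorem derivList_circleIntegral_mul_exp {g : ℂ → ℂ} {a : ℂ} {R : ℝ} (hR : 0 ≤ R)
    (hg : ContinuousOn g (sphere a R)) (l : List ℂ) :
    derivList l (fun w => ∮ ω in C(a, R), g ω * exp (ω * w)) =
      fun w => ∮ ω in C(a, R), (l.map (ω - ·)).prod * g ω * exp (ω * w) := by
  induction l with
  | nil => simp [derivList]
  | cons c l ih =>
    funext w
    have hprod : Continuous fun ω : ℂ => (l.map (ω - ·)).prod :=
      continuous_list_prod _ fun i _ => continuous_id.sub continuous_const
    have hcont : ContinuousOn (fun ω => (l.map (ω - ·)).prod * g ω) (sphere a R) :=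
      hprod.continuousOn.mul hg
    have hexp : ContinuousOn (fun ω => exp (ω * w)) (sphere a R) := by fun_prop
    rw [derivList_cons, ih, (hasDerivAt_circleIntegral_mul_exp hR hcont w).deriv,
      ← circleIntegral.integral_const_mul, ← circleIntegral.integral_sub]
    · refine circleIntegral.integral_congr hR fun ω _ => ?_
      simp only [List.map_cons, List.prod_cons]
      ring
    · exact ((continuousOn_id.mul hcont).mul hexp).circleIntegrable hR
    · exact (continuousOn_const.mul (hcont.mul hexp)).circleIntegrable hR

theorem circleIntegral_comp_sub (f : ℂ → ℂ) (a c : ℂ) (R : ℝ) :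
    (∮ ω in C(a, R), f (ω - c)) = ∮ ω in C(a - c, R), f ω := by
  simp only [circleIntegral, deriv_circleMap]
  refine intervalIntegral.integral_congr fun θ _ => ?_
  simp only [circleMap]
  ring_nf

end EulerMeijer

namespace EulerMeijer

open Metric Complex

/-! ### The kernel of the Meijer functions -/

/-- The integrand of `G_{0,N}^{ℓ,0}` without the factor `x ^ ω`. -/
noncomputable def gammaKernel {N : ℕ} (b : Fin N → ℂ) (B : Finset (Fin N)) (ω : ℂ) : ℂ :=
  (∏ j ∈ B, Gamma (b j - ω)) / ∏ j ∈ Bᶜ, Gamma (1 - b j + ω)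

variable {N : ℕ} {b : Fin N → ℂ} {B : Finset (Fin N)} {β : ℂ}

theorem meijerIntegrand_eq_gammaKernel_mul_exp (b : Fin N → ℂ) (B : Finset (Fin N)) (w : ℂ) :
    meijerIntegrand (p := 0) ![] ∅ b B w = fun ω => gammaKernel b B ω * exp (ω * w) := by
  funext ω
  simp [meijerIntegrand, gammaKernel]

/-- Each Gamma factor contributes `ω - b i`, with a sign for the front ones. The identity for `1/Γ`
holds everywhere, so only indices in `B` need to be avoided. -/
theorem gammaKernel_sub_one {ω : ℂ} (hω : ∀ i ∈ B, ω ≠ b i) :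
    gammaKernel b B (ω - 1) = (-1) ^ B.card * (∏ i, (ω - b i)) * gammaKernel b B ω := by
  have h1 : ∏ j ∈ B, Gamma (b j - (ω - 1)) =
      ((-1) ^ B.card * ∏ j ∈ B, (ω - b j)) * ∏ j ∈ B, Gamma (b j - ω) := by
    rw [← Finset.prod_const, ← Finset.prod_mul_distrib, ← Finset.prod_mul_distrib]
    refine Finset.prod_congr rfl fun i hi => ?_
    rw [show b i - (ω - 1) = b i - ω + 1 by ring,
      Gamma_add_one _ (sub_ne_zero.2 (hω i hi).symm)]
    ring
  have h2 : (∏ j ∈ Bᶜ, Gamma (1 - b j + (ω - 1)))⁻¹ =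
      (∏ j ∈ Bᶜ, (ω - b j)) * (∏ j ∈ Bᶜ, Gamma (1 - b j + ω))⁻¹ := by
    rw [← Finset.prod_inv_distrib, ← Finset.prod_inv_distrib, ← Finset.prod_mul_distrib]
    refine Finset.prod_congr rfl fun i _ => ?_
    rw [show 1 - b i + (ω - 1) = ω - b i by ring,
      one_div_Gamma_eq_self_mul_one_div_Gamma_add_one, show ω - b i + 1 = 1 - b i + ω by ring]
  rw [gammaKernel, gammaKernel, div_eq_mul_inv, div_eq_mul_inv, h1, h2,
    ← Finset.prod_mul_prod_compl B]
  ring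

theorem differentiableAt_gammaKernel {ω : ℂ} (hω : ∀ i ∈ B, ∀ m : ℕ, ω ≠ b i + m) :
    DifferentiableAt ℂ (gammaKernel b B) ω := by
  have h : gammaKernel b B = fun ω => (∏ j ∈ B, Gamma (b j - ω)) *
      ∏ j ∈ Bᶜ, (Gamma (1 - b j + ω))⁻¹ := by
    funext ω
    rw [gammaKernel, div_eq_mul_inv, Finset.prod_inv_distrib]
  rw [h]
  refine DifferentiableAt.mul (DifferentiableAt.fun_finsetProd fun i hi => ?_)
    (DifferentiableAt.fun_finsetProd fun i _ => ?_)
  · refine DifferentiableAt.comp ω (differentiableAt_Gamma _ fun m hm => hω i hi m ?_)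
      ((differentiableAt_const _).sub differentiableAt_id)
    linear_combination -hm
  · exact (differentiable_one_div_Gamma (1 - b i + ω)).comp ω
      ((differentiableAt_const _).add differentiableAt_id)

/-- Every pole of the kernel lies in `β + ℕ`. -/
def PolesIn (b : Fin N → ℂ) (B : Finset (Fin N)) (β : ℂ) : Prop :=
  ∀ i ∈ B, ∃ n : ℕ, b i = β + n

/-- This is why all contours have radius `1/2`: such a closed disc meets `β + ℤ` only in its centre.
-/
theorem int_eq_of_add_mem_closedBall {β : ℂ} {m n : ℤ}
    (h : β + m ∈ closedBall (β + (n : ℂ)) (1 / 2)) : m = n := by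
  rw [mem_closedBall, dist_eq_norm, add_sub_add_left_eq_sub, ← Int.cast_sub, norm_intCast] at h
  have h1 : (|m - n| : ℤ) < 1 := by
    have : ((|m - n| : ℤ) : ℝ) < 1 := by push_cast; push_cast at h; linarith
    exact_mod_cast this
  have := Int.abs_lt_one_iff.1 h1
  omega

theorem PolesIn.differentiableAt (hβ : PolesIn b B β) {n : ℤ} {ω : ℂ}
    (hω : ω ∈ closedBall (β + (n : ℂ)) (1 / 2)) (hne : ω ≠ β + n) :
    DifferentiableAt ℂ (gammaKernel b B) ω := by
  refine differentiableAt_gammaKernel fun i hi m hm => hne ?_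
  obtain ⟨k, hk⟩ := hβ i hi
  have h : ω = β + ((k + m : ℤ) : ℂ) := by rw [hm, hk]; push_cast; ring
  rw [h] at hω ⊢
  rw [int_eq_of_add_mem_closedBall hω]

theorem ne_center_of_mem_sphere {a z : ℂ} (h : z ∈ sphere a (1 / 2)) : z ≠ a := by
  rintro rfl
  simp at h

theorem PolesIn.continuousOn_sphere (hβ : PolesIn b B β) (n : ℤ) :
    ContinuousOn (gammaKernel b B) (sphere (β + (n : ℂ)) (1 / 2)) := fun _ hω =>
  (hβ.differentiableAt (sphere_subset_closedBall hω)
    (ne_center_of_mem_sphere hω)).continuousAt.continuousWithinAt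

theorem PolesIn.differentiableAt_of_notMem (hβ : PolesIn b B β) {n : ℤ}
    (hn : β + (n : ℂ) ∉ meijerPoles b B) {ω : ℂ} (hω : ω ∈ closedBall (β + (n : ℂ)) (1 / 2)) :
    DifferentiableAt ℂ (gammaKernel b B) ω := by
  by_cases h : ω = β + n
  · exact differentiableAt_gammaKernel fun i hi m hm => hn ⟨i, hi, m, h ▸ hm⟩
  · exact hβ.differentiableAt hω h

theorem PolesIn.circleIntegral_eq_zero (hβ : PolesIn b B β) {n : ℤ}
    (hn : β + (n : ℂ) ∉ meijerPoles b B) (w : ℂ) :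
    (∮ ω in C(β + (n : ℂ), 1 / 2), gammaKernel b B ω * exp (ω * w)) = 0 := by
  have hd : ∀ z ∈ closedBall (β + (n : ℂ)) (1 / 2),
      DifferentiableAt ℂ (fun ω => gammaKernel b B ω * exp (ω * w)) z := fun z hz =>
    (hβ.differentiableAt_of_notMem hn hz).mul (by fun_prop)
  exact circleIntegral_eq_zero_of_differentiable_on_off_countable (by norm_num)
    Set.countable_empty (fun z hz => (hd z hz).continuousAt.continuousWithinAt)
    fun z hz => hd z (ball_subset_closedBall hz.1)

/-- The integrand is holomorphic on the punctured disc, so the integrals in the limit defining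
`residue` are constant for radii below `1/2`. -/
theorem PolesIn.residue_eq (hβ : PolesIn b B β) (n : ℤ) (w : ℂ) :
    residue (meijerIntegrand (p := 0) ![] ∅ b B w) (β + n) =
      (2 * (Real.pi : ℂ) * I)⁻¹ *
        ∮ ω in C(β + (n : ℂ), 1 / 2), gammaKernel b B ω * exp (ω * w) := by
  rw [meijerIntegrand_eq_gammaKernel_mul_exp]
  refine Tendsto.limUnder_eq (tendsto_const_nhds.congr' ?_)
  filter_upwards [Ioo_mem_nhdsGT (show (0 : ℝ) < 1 / 2 by norm_num)] with ρ hρ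
  have hd : ∀ z ∈ closedBall (β + (n : ℂ)) (1 / 2), z ≠ β + n →
      DifferentiableAt ℂ (fun ω => gammaKernel b B ω * exp (ω * w)) z := fun z hz hne =>
    (hβ.differentiableAt hz hne).mul (by fun_prop)
  congr 1
  refine circleIntegral_eq_of_differentiable_on_annulus_off_countable hρ.1 hρ.2.le
    Set.countable_empty (fun z hz => (hd z hz.1 ?_).continuousAt.continuousWithinAt)
    fun z hz => hd z (ball_subset_closedBall hz.1.1) ?_
  · rintro rfl
    exact hz.2 (mem_ball_self hρ.1)
  · rintro rfl
    exact hz.1.2 (mem_closedBall_self hρ.1.le)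

/-- The contribution of the point `β + n` to the Meijer function, up to the factor `-(2πi)⁻¹`. -/
noncomputable def poleIntegral (b : Fin N → ℂ) (B : Finset (Fin N)) (β : ℂ) (n : ℕ) (w : ℂ) : ℂ :=
  ∮ ω in C(β + (n : ℂ), 1 / 2), gammaKernel b B ω * exp (ω * w)

/-- In the recurrence every factor `ω + n + 1 - b i` eventually exceeds `X`, and there is at least
one factor: the kernel decays faster than any geometric sequence. -/
theorem PolesIn.norm_gammaKernel_add_one (hβ : PolesIn b B β) (hN : 0 < N) {X : ℝ} (hX : 1 ≤ X) :
    ∀ᶠ n : ℕ in atTop, ∀ ω ∈ sphere β (1 / 2),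
      X * ‖gammaKernel b B (ω + (n + 1 : ℕ))‖ ≤ ‖gammaKernel b B (ω + n)‖ := by
  obtain ⟨n₀, hn₀⟩ := exists_nat_ge (X + ‖β‖ + 1 / 2 + ∑ i, ‖b i‖)
  filter_upwards [eventually_ge_atTop n₀] with n hn ω hω
  have hn' : (n₀ : ℝ) ≤ n := by exact_mod_cast hn
  have hrec : gammaKernel b B (ω + n) = (-1) ^ B.card * (∏ i, (ω + (n + 1 : ℕ) - b i)) *
      gammaKernel b B (ω + (n + 1 : ℕ)) := by
    rw [← gammaKernel_sub_one]
    · push_cast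
      ring_nf
    · intro i hi h
      obtain ⟨k, hk⟩ := hβ i hi
      have h1 : ω = β + ((k - (n + 1) : ℤ) : ℂ) := by
        push_cast at h ⊢
        linear_combination h + hk
      have h2 : ω ∈ closedBall (β + ((0 : ℤ) : ℂ)) (1 / 2) := by
        simpa using sphere_subset_closedBall hω
      have h3 := h2
      rw [h1] at h3
      rw [int_eq_of_add_mem_closedBall h3] at h1
      exact ne_center_of_mem_sphere hω (by simpa using h1)
  have hfac : ∀ i, X ≤ ‖ω + (n + 1 : ℕ) - b i‖ := by
    intro i
    have h1 : ‖ω‖ ≤ ‖β‖ + 1 / 2 := by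
      calc ‖ω‖ = ‖β + (ω - β)‖ := by ring_nf
        _ ≤ ‖β‖ + ‖ω - β‖ := norm_add_le _ _
        _ = ‖β‖ + 1 / 2 := by rw [mem_sphere_iff_norm.1 hω]
    have h2 : ‖b i‖ ≤ ∑ i, ‖b i‖ :=
      Finset.single_le_sum (f := fun i => ‖b i‖) (fun _ _ => norm_nonneg _) (Finset.mem_univ i)
    have h3 : (n : ℝ) + 1 ≤ ‖ω + (n + 1 : ℕ) - b i‖ + ‖ω‖ + ‖b i‖ := by
      calc (n : ℝ) + 1 = ‖((n + 1 : ℕ) : ℂ)‖ := by rw [norm_natCast]; push_cast; rfl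
        _ = ‖(ω + (n + 1 : ℕ) - b i) - ω + b i‖ := by ring_nf
        _ ≤ _ := (norm_add_le _ _).trans (by gcongr; exact norm_sub_le _ _)
    linarith
  have hprod : X ≤ ‖∏ i, (ω + (n + 1 : ℕ) - b i)‖ := by
    rw [norm_prod]
    calc X ≤ X ^ N := le_self_pow₀ hX hN.ne'
      _ = ∏ _i : Fin N, X := by simp
      _ ≤ _ := Finset.prod_le_prod (fun _ _ => by linarith) fun i _ => hfac i
  rw [hrec, norm_mul, norm_mul, norm_pow, norm_neg, norm_one, one_pow, one_mul]
  gcongr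

theorem PolesIn.isNormallySummable (hβ : PolesIn b B β) (hN : 0 < N) :
    IsNormallySummable (poleIntegral b B β) := by
  have hcont : ∀ n : ℕ, ContinuousOn (gammaKernel b B) (sphere (β + (n : ℂ)) (1 / 2)) := fun n => by
    simpa using hβ.continuousOn_sphere n
  refine ⟨fun n w => (hasDerivAt_circleIntegral_mul_exp (by norm_num)
    (hcont n) w).differentiableAt, fun R => ?_⟩
  have hmaps : ∀ n : ℕ, Set.MapsTo (fun ω : ℂ => ω + n) (sphere β (1 / 2))
      (sphere (β + (n : ℂ)) (1 / 2)) := fun n ω hω => by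
    simpa [mem_sphere_iff_norm] using hω
  have hmax : ∀ n : ℕ, ∃ z ∈ sphere β (1 / 2), ∀ ω ∈ sphere β (1 / 2),
      ‖gammaKernel b B (ω + n)‖ ≤ ‖gammaKernel b B (z + n)‖ := fun n =>
    (isCompact_sphere β (1 / 2)).exists_isMaxOn (NormedSpace.sphere_nonempty.2 (by norm_num))
      (((hcont n).comp (by fun_prop) (hmaps n)).norm)
  choose z hz hmax using hmax
  set M : ℕ → ℝ := fun n => ‖gammaKernel b B (z n + n)‖ with hM
  refine ⟨fun n => 2 * Real.pi * (1 / 2) * (M n * Real.exp ((‖β‖ + n + 1 / 2) * R)), ?_, ?_⟩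
  · refine Summable.mul_left _ ?_
    refine summable_of_ratio_norm_eventually_le (r := 1 / 2) (by norm_num) ?_
    -- The bound for the exponential grows by `e^R` per step; decay of the kernel by `2 e^|R|`
    -- leaves a ratio of at most `1/2`.
    have hX : 1 ≤ 2 * Real.exp |R| := by
      have := Real.one_le_exp (abs_nonneg R)
      linarith
    filter_upwards [hβ.norm_gammaKernel_add_one hN hX] with n hn
    have h1 : 2 * Real.exp |R| * M (n + 1) ≤ M n :=
      (hn _ (hz (n + 1))).trans (hmax n _ (hz (n + 1)))
    have h2 : Real.exp R ≤ Real.exp |R| := Real.exp_le_exp.2 (le_abs_self R)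
    have h3 : Real.exp ((‖β‖ + (n + 1 : ℕ) + 1 / 2) * R) =
        Real.exp ((‖β‖ + n + 1 / 2) * R) * Real.exp R := by
      rw [← Real.exp_add]
      push_cast
      ring_nf
    have hM0 : 0 ≤ M (n + 1) := norm_nonneg _
    have hM1 : 0 ≤ M n := norm_nonneg _
    rw [Real.norm_of_nonneg (by positivity), Real.norm_of_nonneg (by positivity), h3]
    have h4 : M (n + 1) * Real.exp R ≤ 1 / 2 * M n := by
      have := mul_le_mul_of_nonneg_left h2 hM0
      linarith
    have h5 := mul_le_mul_of_nonneg_right h4 (Real.exp_pos ((‖β‖ + n + 1 / 2) * R)).le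
    linarith
  · intro n w hw
    refine circleIntegral.norm_integral_le_of_norm_le_const (by norm_num) fun ω hω => ?_
    have hω' : ω - n ∈ sphere β (1 / 2) := by
      rw [mem_sphere_iff_norm] at hω ⊢
      rw [← hω]
      ring_nf
    have h1 : ‖gammaKernel b B ω‖ ≤ M n := by simpa using hmax n _ hω'
    have h2 : ‖ω‖ ≤ ‖β‖ + n + 1 / 2 := by
      calc ‖ω‖ = ‖β + n + (ω - (β + n))‖ := by ring_nf
        _ ≤ ‖β‖ + ‖(n : ℂ)‖ + ‖ω - (β + n)‖ := norm_add₃_le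
        _ = ‖β‖ + n + 1 / 2 := by rw [mem_sphere_iff_norm.1 hω, norm_natCast]
    rw [norm_mul]
    gcongr
    refine (norm_exp_le_exp_norm _).trans (Real.exp_le_exp.2 ?_)
    rw [norm_mul]
    gcongr

/-- The sum of the residues over the points `β + n`, times `2πi`. -/
noncomputable def poleSum (b : Fin N → ℂ) (B : Finset (Fin N)) (β : ℂ) (w : ℂ) : ℂ :=
  ∑' n, poleIntegral b B β n w

theorem PolesIn.residue_eq_poleIntegral (hβ : PolesIn b B β) (n : ℕ) (w : ℂ) :
    residue (meijerIntegrand (p := 0) ![] ∅ b B w) (β + n) =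
      (2 * (Real.pi : ℂ) * I)⁻¹ * poleIntegral b B β n w := by
  simpa [poleIntegral] using hβ.residue_eq n w

/-- Points `β + n` that are not in `meijerPoles b B` carry a zero integral, so the sum over this set
can be replaced by a series over all `n`. -/
theorem PolesIn.indicator_residue (hβ : PolesIn b B β) (n : ℕ) (w : ℂ) :
    (meijerPoles b B).indicator (residue (meijerIntegrand (p := 0) ![] ∅ b B w)) (β + n) =
      (2 * (Real.pi : ℂ) * I)⁻¹ * poleIntegral b B β n w := by
  rw [← hβ.residue_eq_poleIntegral]
  by_cases h : β + (n : ℂ) ∈ meijerPoles b B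
  · rw [Set.indicator_of_mem h]
  · rw [Set.indicator_of_notMem h, hβ.residue_eq_poleIntegral, poleIntegral]
    have := hβ.circleIntegral_eq_zero (n := n) (by simpa using h) w
    simp only [Int.cast_natCast] at this
    rw [this, mul_zero]

theorem PolesIn.meijerPoles_subset (hβ : PolesIn b B β) :
    meijerPoles b B ⊆ Set.range fun n : ℕ => β + n := by
  rintro _ ⟨i, hi, m, rfl⟩
  obtain ⟨k, hk⟩ := hβ i hi
  exact ⟨k + m, by simp only [hk]; push_cast; ring⟩

theorem add_natCast_injective (β : ℂ) : Function.Injective fun n : ℕ => β + (n : ℂ) :=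
  fun m n h => by simpa using h

theorem PolesIn.meijerG_eq (hβ : PolesIn b B β) (w : ℂ) :
    meijerG (p := 0) ![] ∅ b B w = -(2 * (Real.pi : ℂ) * I)⁻¹ * poleSum b B β w := by
  rw [meijerG, tsum_subtype (meijerPoles b B) (residue _),
    ← (add_natCast_injective β).tsum_eq (Set.support_indicator_subset.trans
      hβ.meijerPoles_subset)]
  simp only [hβ.indicator_residue, tsum_mul_left, poleSum, neg_mul]

theorem PolesIn.summable_norm_residue (hβ : PolesIn b B β) (hN : 0 < N) (w : ℂ) :
    Summable fun ω : meijerPoles b B =>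
      ‖residue (meijerIntegrand (p := 0) ![] ∅ b B w) ω‖ := by
  have h : Summable fun ω : meijerPoles b B =>
      residue (meijerIntegrand (p := 0) ![] ∅ b B w) ω := by
    refine (summable_subtype_iff_indicator (f := residue _) (s := meijerPoles b B)).2 ?_
    refine ((add_natCast_injective β).summable_iff fun x hx =>
      Set.indicator_of_notMem (fun h => hx (hβ.meijerPoles_subset h)) _).1 ?_
    refine (((hβ.isNormallySummable hN).summable w).mul_left (2 * (Real.pi : ℂ) * I)⁻¹).congr
      fun n => ?_
    exact (hβ.indicator_residue n w).symm
  exact h.norm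

theorem PolesIn.differentiable_poleSum (hβ : PolesIn b B β) (hN : 0 < N) :
    Differentiable ℂ (poleSum b B β) :=
  (hβ.isNormallySummable hN).differentiable_tsum

/-- The weight `∏ (ω - b i)` turns `K(ω)` into `±K(ω - 1)`; translating the contour by one releases
`exp w`. The centre index is an integer because `n = 0` leads to `β - 1`. -/
theorem PolesIn.derivList_poleIntegral (hβ : PolesIn b B β) (n : ℕ) (w : ℂ) :
    derivList (List.ofFn b) (poleIntegral b B β n) w = (-1) ^ B.card * exp w *
      ∮ ω in C(β + ((n - 1 : ℤ) : ℂ), 1 / 2), gammaKernel b B ω * exp (ω * w) := by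
  have hcont : ContinuousOn (gammaKernel b B) (sphere (β + (n : ℂ)) (1 / 2)) := by
    simpa using hβ.continuousOn_sphere n
  have h := congrFun (derivList_circleIntegral_mul_exp (by norm_num) hcont (List.ofFn b)) w
  have hc : β + ((n - 1 : ℤ) : ℂ) = β + n - 1 := by push_cast; ring
  rw [hc, ← circleIntegral_comp_sub, ← circleIntegral.integral_const_mul]
  refine h.trans (circleIntegral.integral_congr (by norm_num) fun ω hω => ?_)
  have hne : ∀ i ∈ B, ω ≠ b i := by
    rintro i hi rfl
    obtain ⟨k, hk⟩ := hβ i hi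
    have h1 : β + ((k : ℤ) : ℂ) ∈ closedBall (β + ((n : ℤ) : ℂ)) (1 / 2) := by
      simpa [← hk] using sphere_subset_closedBall hω
    have h2 := int_eq_of_add_mem_closedBall h1
    refine ne_center_of_mem_sphere hω ?_
    rw [hk, Int.natCast_inj.1 h2]
  simp only [List.map_ofFn, List.prod_ofFn, Function.comp]
  rw [gammaKernel_sub_one hne, sub_mul, one_mul, exp_sub]
  have h1 : ((-1 : ℂ) ^ B.card) * (-1) ^ B.card = 1 := by
    rw [← mul_pow]; simp
  field_simp
  linear_combination (-(∏ i, (ω - b i)) * gammaKernel b B ω) * h1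

theorem PolesIn.derivList_poleSum (hβ : PolesIn b B β) (hN : 0 < N) (w : ℂ) :
    derivList (List.ofFn b) (poleSum b B β) w =
      (-1) ^ B.card * exp w * poleSum b B β w := by
  have hs := hβ.isNormallySummable hN
  have h := congrFun (hs.derivList_tsum (List.ofFn b)) w
  refine h.trans ?_
  -- The term `n = 0` now sits at `β - 1`, to the left of all poles, and vanishes; the others
  -- reproduce the series.
  rw [((hs.derivList (List.ofFn b)).summable w).tsum_eq_zero_add, hβ.derivList_poleIntegral,
    hβ.circleIntegral_eq_zero, mul_zero, zero_add, poleSum, ← tsum_mul_left]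
  · refine tsum_congr fun n => ?_
    rw [hβ.derivList_poleIntegral, poleIntegral]
    simp
  · rintro ⟨i, hi, m, h⟩
    obtain ⟨k, hk⟩ := hβ i hi
    rw [hk] at h
    have h1 : (((0 : ℕ) - 1 : ℤ) : ℂ) = ((k + m : ℤ) : ℂ) := by
      push_cast at h ⊢
      linear_combination h
    have h2 : ((0 : ℕ) - 1 : ℤ) = (k + m : ℤ) := by exact_mod_cast h1
    omega

end EulerMeijer

namespace EulerMeijer

open Metric Complex

/-! ### Monodromy -/

/-- The translation `f ↦ f (· + a)`. -/
def shift (a : ℂ) : Module.End ℂ (ℂ → ℂ) := LinearMap.funLeft ℂ ℂ (· + a)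

@[simp]
theorem shift_apply (a : ℂ) (f : ℂ → ℂ) (w : ℂ) : shift a f w = f (w + a) := rfl

theorem commute_shift (a a' : ℂ) : Commute (shift a) (shift a') := by
  refine LinearMap.ext fun f => funext fun w => ?_
  simp only [Module.End.mul_apply, shift_apply]
  ring_nf

theorem shift_injective (a : ℂ) : Function.Injective (shift a) := fun f g h => funext fun w => by
  simpa using congrFun h (w - a)

/-- Translations do not change the rank of a generalized eigenvector of the monodromy. -/
theorem pow_shift_sub_apply_shift (α a : ℂ) (m : ℕ) (f : ℂ → ℂ) :
    ((shift (2 * Real.pi * I) - algebraMap ℂ _ α) ^ m) (shift a f) =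
      shift a (((shift (2 * Real.pi * I) - algebraMap ℂ _ α) ^ m) f) := by
  have h : Commute ((shift (2 * Real.pi * I) - algebraMap ℂ _ α) ^ m) (shift a) :=
    ((commute_shift _ a).sub_left (Algebra.commutes α (shift a))).pow_left m
  exact LinearMap.congr_fun h.eq f

variable {N : ℕ} {b : Fin N → ℂ} {B : Finset (Fin N)} {β : ℂ}

/-- Moving `b j` to the front multiplies the kernel by `Γ(b_j - ω) Γ(1 - b_j + ω) = π / sin π(b_j -
ω)`, and the difference of exponentials contains the same sine. -/
theorem gammaKernel_insert_mul {j : Fin N} (hj : j ∉ B) {ω : ℂ}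
    (hω : ∀ n : ℤ, ω ≠ b j + n) :
    gammaKernel b (insert j B) ω * (exp (ω * (2 * Real.pi * I)) - exp (b j * (2 * Real.pi * I))) =
      -(2 * Real.pi * I) * exp (Real.pi * I * b j) *
        (gammaKernel b B ω * exp (ω * (Real.pi * I))) := by
  have hG1 : Gamma (1 - b j + ω) ≠ 0 := Gamma_ne_zero fun m hm => hω (-(m + 1)) (by
    push_cast; linear_combination hm)
  have hG2 : Gamma (b j - ω) ≠ 0 := Gamma_ne_zero fun m hm => hω m (by
    push_cast; linear_combination -hm)
  have hrefl := Gamma_mul_Gamma_one_sub (b j - ω)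
  rw [show 1 - (b j - ω) = 1 - b j + ω by ring] at hrefl
  have hsin : sin (Real.pi * (b j - ω)) ≠ 0 := by
    intro h
    rw [h, div_zero] at hrefl
    exact mul_ne_zero hG2 hG1 hrefl
  have hker : gammaKernel b (insert j B) ω =
      gammaKernel b B ω * (Gamma (b j - ω) * Gamma (1 - b j + ω)) := by
    have hc : Bᶜ = insert j (insert j B)ᶜ := by
      ext i
      by_cases h : i = j <;> simp [h, hj]
    rw [gammaKernel, gammaKernel, Finset.prod_insert hj, hc, Finset.prod_insert (by simp)]
    generalize ∏ i ∈ (insert j B)ᶜ, Gamma (1 - b i + ω) = P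
    -- `Gamma` has the value 0 at its poles, so `P` can vanish; both quotients are then 0.
    rcases eq_or_ne P 0 with rfl | hP
    · simp
    · field_simp
  have hexp : exp (ω * (2 * Real.pi * I)) - exp (b j * (2 * Real.pi * I)) =
      -(2 * I) * exp (Real.pi * I * b j) * exp (ω * (Real.pi * I)) *
        sin (Real.pi * (b j - ω)) := by
    have e1 : exp (ω * (2 * Real.pi * I)) = exp (Real.pi * I * b j) * exp (ω * (Real.pi * I)) *
        exp (-(Real.pi * (b j - ω)) * I) := by
      rw [← exp_add, ← exp_add]; ring_nf
    have e2 : exp (b j * (2 * Real.pi * I)) = exp (Real.pi * I * b j) * exp (ω * (Real.pi * I)) *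
        exp (Real.pi * (b j - ω) * I) := by
      rw [← exp_add, ← exp_add]; ring_nf
    rw [e1, e2, sin]
    linear_combination (exp (Real.pi * I * b j) * exp (ω * (Real.pi * I)) *
      (exp (-(Real.pi * (b j - ω)) * I) - exp (Real.pi * (b j - ω) * I))) * I_sq
  rw [hker, hrefl, hexp]
  field_simp

theorem PolesIn.mono {B' : Finset (Fin N)} (hβ : PolesIn b B β) (h : B' ⊆ B) : PolesIn b B' β :=
  fun i hi => hβ i (h hi)

theorem PolesIn.monodromy_poleSum (hN : 0 < N) {j : Fin N} (hj : j ∉ B)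
    (hβ : PolesIn b (insert j B) β) :
    (shift (2 * Real.pi * I) - algebraMap ℂ _ (exp (b j * (2 * Real.pi * I))))
        (poleSum b (insert j B) β) =
      (-(2 * Real.pi * I) * exp (Real.pi * I * b j)) •
        shift (Real.pi * I) (poleSum b B β) := by
  funext w
  have hs := hβ.isNormallySummable hN
  simp only [LinearMap.sub_apply, Module.algebraMap_end_apply, Pi.sub_apply, Pi.smul_apply,
    shift_apply, smul_eq_mul, poleSum]
  rw [← tsum_mul_left, ← tsum_mul_left,
    ← (hs.summable (w + 2 * Real.pi * I)).tsum_sub ((hs.summable w).mul_left _)]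
  refine tsum_congr fun n => ?_
  have hcont : ContinuousOn (gammaKernel b (insert j B)) (sphere (β + (n : ℂ)) (1 / 2)) := by
    simpa using hβ.continuousOn_sphere n
  have hexp : ∀ v : ℂ, ContinuousOn (fun ω => exp (ω * v)) (sphere (β + (n : ℂ)) (1 / 2)) :=
    fun v => by fun_prop
  simp only [poleIntegral]
  rw [← circleIntegral.integral_const_mul, ← circleIntegral.integral_const_mul,
    ← circleIntegral.integral_sub]
  rotate_left
  · exact (hcont.mul (hexp _)).circleIntegrable (by norm_num)
  · exact (continuousOn_const.mul (hcont.mul (hexp _))).circleIntegrable (by norm_num)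
  refine circleIntegral.integral_congr (by norm_num) fun ω hω => ?_
  obtain ⟨k, hk⟩ := hβ j (Finset.mem_insert_self j B)
  have hne : ∀ m : ℤ, ω ≠ b j + m := by
    intro m hm
    have h1 : ω = β + ((k + m : ℤ) : ℂ) := by rw [hm, hk]; push_cast; ring
    have h2 : β + ((k + m : ℤ) : ℂ) ∈ closedBall (β + ((n : ℤ) : ℂ)) (1 / 2) := by
      rw [← h1]; simpa using sphere_subset_closedBall hω
    rw [int_eq_of_add_mem_closedBall h2] at h1
    exact ne_center_of_mem_sphere hω (by simpa using h1)
  have h := gammaKernel_insert_mul hj hne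
  simp only [mul_add, exp_add]
  linear_combination exp (ω * w) * h

/-- Without front parameters the kernel is entire. This makes the first function of a block a true
eigenvector. -/
theorem poleSum_empty (b : Fin N → ℂ) (β : ℂ) : poleSum b ∅ β = 0 := by
  funext w
  have hβ : PolesIn b ∅ β := fun i hi => absurd hi (Finset.notMem_empty i)
  refine (tsum_congr fun n => ?_).trans tsum_zero
  have := hβ.circleIntegral_eq_zero (n := n) (by rintro ⟨i, hi, _⟩; simp at hi) w
  simpa [poleIntegral] using this

/-! ### A single front parameter -/

theorem Gamma_add_natCast_eq_ascPochhammer {s : ℂ} (hs : ∀ m : ℕ, s ≠ -m) (n : ℕ) :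
    Gamma (s + n) = (ascPochhammer ℂ n).eval s * Gamma s := by
  rw [← Gamma_add_nat_div_Gamma_eq s hs, div_mul_cancel₀ _ (Gamma_ne_zero hs)]

/-- The factor `s + n` stands apart because, for `s = b j - ω`, it is the one that vanishes at `ω =
b j + n`. -/
theorem Gamma_add_natCast_add_one_eq {s : ℂ} (n : ℕ) (hs : ∀ m ≤ n, s ≠ -(m : ℂ)) :
    Gamma (s + (n + 1)) = (∏ k ∈ Finset.range n, (s + k)) * (s + n) * Gamma s := by
  induction n with
  | zero => simpa using Gamma_add_one s (by simpa using hs 0 le_rfl)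
  | succ n ih =>
    have h := ih fun m hm => hs m (hm.trans (Nat.le_succ n))
    rw [Finset.prod_range_succ, show s + ((n + 1 : ℕ) + 1 : ℂ) = s + (n + 1) + 1 by push_cast; ring,
      Gamma_add_one, h]
    · push_cast; ring
    · intro h0
      refine hs (n + 1) le_rfl (eq_neg_of_add_eq_zero_left ?_)
      push_cast
      exact h0

theorem prod_range_sub_natCast (n : ℕ) :
    ∏ k ∈ Finset.range n, ((k : ℂ) - n) = (-1) ^ n * (n.factorial : ℂ) := by
  rw [← Finset.prod_range_reflect, ← Finset.prod_range_add_one_eq_factorial, Nat.cast_prod,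
    ← Finset.card_range n, ← Finset.prod_const, Finset.card_range, ← Finset.prod_mul_distrib]
  refine Finset.prod_congr rfl fun k hk => ?_
  have hk' : k + 1 ≤ n := Finset.mem_range.1 hk
  rw [show n - 1 - k = n - (k + 1) by omega, Nat.cast_sub hk']
  push_cast
  ring

/-- The coefficient of `x ^ (b_j + n)` in `G_{0,N}^{1,0}`. -/
noncomputable def singleCoeff (b : Fin N → ℂ) (j : Fin N) (n : ℕ) : ℂ :=
  (-1) ^ n / (n.factorial : ℂ) * ∏ i ∈ {j}ᶜ, (Gamma (1 - b i + (b j + n)))⁻¹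

theorem poleIntegral_singleton (b : Fin N → ℂ) (j : Fin N) (n : ℕ) (w : ℂ) :
    poleIntegral b {j} (b j) n w =
      -(2 * Real.pi * I) * (singleCoeff b j n * exp ((b j + n) * w)) := by
  -- `h` is the integrand times `ω - (b j + n)`, extended holomorphically over the simple pole;
  -- Cauchy's formula then gives the integral.
  let h : ℂ → ℂ := fun ω => -(Gamma (b j - ω + (n + 1)) /
    (∏ k ∈ Finset.range n, (b j - ω + k)) * (∏ i ∈ {j}ᶜ, (Gamma (1 - b i + ω))⁻¹) * exp (ω * w))
  have hne : ∀ ω ∈ closedBall (b j + (n : ℂ)) (1 / 2), ∀ m : ℤ, m ≠ n → b j - ω + m ≠ 0 := by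
    intro ω hω m hm h0
    have h1 : ω = b j + (m : ℂ) := by linear_combination -h0
    refine hm (int_eq_of_add_mem_closedBall (β := b j) ?_)
    rw [← h1]
    simpa using hω
  have hprod : ∀ ω ∈ closedBall (b j + (n : ℂ)) (1 / 2),
      ∏ k ∈ Finset.range n, (b j - ω + k) ≠ 0 := fun ω hω =>
    Finset.prod_ne_zero_iff.2 fun k hk => by
      have := hne ω hω k (by have := Finset.mem_range.1 hk; omega)
      simpa using this
  have hdiff : ∀ ω ∈ closedBall (b j + (n : ℂ)) (1 / 2), DifferentiableAt ℂ h ω := by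
    intro ω hω
    have h1 : DifferentiableAt ℂ (fun ω => Gamma (b j - ω + (n + 1))) ω := by
      refine DifferentiableAt.comp ω (differentiableAt_Gamma _ fun m hm => ?_) (by fun_prop)
      refine hne ω hω (m + n + 1) (by omega) ?_
      push_cast
      linear_combination hm
    have h2 : DifferentiableAt ℂ (fun ω => ∏ k ∈ Finset.range n, (b j - ω + k)) ω :=
      DifferentiableAt.fun_finsetProd fun k _ => by fun_prop
    have h3 : DifferentiableAt ℂ (fun ω => ∏ i ∈ {j}ᶜ, (Gamma (1 - b i + ω))⁻¹) ω :=
      DifferentiableAt.fun_finsetProd fun i _ =>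
        (differentiable_one_div_Gamma (1 - b i + ω)).comp ω (by fun_prop)
    exact (((h1.fun_div h2 (hprod ω hω)).fun_mul h3).fun_mul (by fun_prop)).fun_neg
  have hint := circleIntegral_sub_center_inv_smul_of_differentiable_on_off_countable
    (show (0 : ℝ) < 1 / 2 by norm_num) Set.countable_empty
    (fun z hz => (hdiff z hz).continuousAt.continuousWithinAt)
    fun z hz => hdiff z (ball_subset_closedBall hz.1)
  have hval : h (b j + n) = -(singleCoeff b j n * exp ((b j + n) * w)) := by
    have h1 : ∏ k ∈ Finset.range n, (b j - (b j + n) + k) = (-1) ^ n * (n.factorial : ℂ) := by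
      rw [← prod_range_sub_natCast]
      exact Finset.prod_congr rfl fun k _ => by ring
    have h2 : b j - (b j + n) + ((n : ℂ) + 1) = 1 := by ring
    have h3 : (1 : ℂ) / ((-1) ^ n * (n.factorial : ℂ)) = (-1) ^ n / (n.factorial : ℂ) := by
      have h4 : ((-1 : ℂ) ^ n) * (-1) ^ n = 1 := by rw [← mul_pow]; simp
      have h5 : (n.factorial : ℂ) ≠ 0 := by exact_mod_cast n.factorial_ne_zero
      rw [div_eq_div_iff (mul_ne_zero (left_ne_zero_of_mul_eq_one h4) h5) h5]
      linear_combination -(n.factorial : ℂ) * h4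
    simp only [h, h1, h2, Gamma_one, h3, singleCoeff]
  rw [poleIntegral]
  refine (circleIntegral.integral_congr (by norm_num) fun ω hω => ?_).trans (hint.trans ?_)
  · have hωc := sphere_subset_closedBall hω
    have hne0 : ω - (b j + n) ≠ 0 := sub_ne_zero.2 (ne_center_of_mem_sphere hω)
    have hG := Gamma_add_natCast_add_one_eq (s := b j - ω) n fun m _ h0 => by
      by_cases hmn : m = n
      · exact hne0 (by rw [← hmn]; linear_combination -h0)
      · exact hne ω hωc m (by exact_mod_cast hmn) (by push_cast; linear_combination h0)
    simp only [h, gammaKernel, Finset.prod_singleton, smul_eq_mul, hG]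
    rw [Finset.prod_inv_distrib, div_eq_mul_inv]
    have := hprod ω hωc
    rw [show b j - ω + (n : ℂ) = -(ω - (b j + n)) by ring]
    field_simp
  · rw [hval, smul_eq_mul]
    ring

theorem polesIn_singleton (b : Fin N → ℂ) (j : Fin N) : PolesIn b {j} (b j) := fun i hi =>
  ⟨0, by rw [Finset.mem_singleton.1 hi]; simp⟩

theorem meijerG_singleton (b : Fin N → ℂ) (j : Fin N) (w : ℂ) :
    meijerG (p := 0) ![] ∅ b {j} w = ∑' n, singleCoeff b j n * exp ((b j + n) * w) := by
  have hpi : (2 * Real.pi * I : ℂ) ≠ 0 := two_pi_I_ne_zero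
  rw [(polesIn_singleton b j).meijerG_eq, poleSum, ← tsum_mul_left]
  refine tsum_congr fun n => ?_
  rw [poleIntegral_singleton]
  field_simp

/-- Up to `exp (b j * w)` the sum is a power series in `x = exp w`. Were it zero for all `x ≠ 0`,
continuity at 0 would kill its constant term `∏ 1/Γ(1 - b_i + b_j)`. -/
theorem poleSum_singleton_ne_zero (hN : 0 < N) {j : Fin N}
    (hj : ∀ i ≠ j, ∀ m : ℕ, 1 - b i + b j ≠ -m) : poleSum b {j} (b j) ≠ 0 := by
  intro h0
  have hpi : (2 * Real.pi * I : ℂ) ≠ 0 := two_pi_I_ne_zero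
  have hs : Summable fun n => ‖singleCoeff b j n‖ := by
    have := ((polesIn_singleton b j).isNormallySummable hN).summable_norm 0
    simp only [poleIntegral_singleton, mul_zero, exp_zero, mul_one] at this
    refine (this.mul_left ‖(2 * Real.pi * I : ℂ)‖⁻¹).congr fun n => ?_
    rw [norm_mul (-(2 * Real.pi * I) : ℂ), norm_neg, inv_mul_cancel_left₀ (norm_ne_zero_iff.2 hpi)]
  have hcont : ContinuousOn (fun x : ℂ => ∑' n, singleCoeff b j n * x ^ n) (closedBall 0 1) := by
    refine continuousOn_tsum (fun n => by fun_prop) hs fun n x hx => ?_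
    rw [norm_mul, norm_pow]
    exact mul_le_of_le_one_right (norm_nonneg _)
      (pow_le_one₀ (norm_nonneg _) (mem_closedBall_zero_iff.1 hx))
  have hzero : ∀ x : ℂ, x ≠ 0 → ∑' n, singleCoeff b j n * x ^ n = 0 := by
    intro x hx
    have h1 := (polesIn_singleton b j).meijerG_eq (log x)
    rw [h0, Pi.zero_apply, mul_zero, meijerG_singleton] at h1
    have h2 : ∀ n : ℕ, singleCoeff b j n * exp ((b j + n) * log x) =
        exp (b j * log x) * (singleCoeff b j n * x ^ n) := fun n => by
      rw [add_mul, exp_add, exp_nat_mul, exp_log hx]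
      ring
    simp only [h2, tsum_mul_left] at h1
    exact (mul_eq_zero.1 h1).resolve_left (exp_ne_zero _)
  have hca : ContinuousAt (fun x : ℂ => ∑' n, singleCoeff b j n * x ^ n) 0 :=
    hcont.continuousAt (closedBall_mem_nhds 0 one_pos)
  have hlim : Tendsto (fun x : ℂ => ∑' n, singleCoeff b j n * x ^ n) (𝓝[≠] 0) (𝓝 0) :=
    tendsto_const_nhds.congr' (by
      filter_upwards [self_mem_nhdsWithin] with x hx using (hzero x hx).symm)
  have hval := tendsto_nhds_unique (hca.tendsto.mono_left nhdsWithin_le_nhds) hlim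
  rw [tsum_eq_single 0 (fun n hn => by simp [hn])] at hval
  simp only [singleCoeff, pow_zero, Nat.factorial_zero, Nat.cast_one, div_one, Nat.cast_zero,
    add_zero, one_mul, mul_one, Finset.prod_eq_zero_iff, inv_eq_zero] at hval
  obtain ⟨i, hi, h⟩ := hval
  exact Gamma_ne_zero (hj i (by simpa using hi)) h

/-- Termwise `Γ(s + n) = (s)_n Γ(s)`; the sign of the residue cancels that of `(-ζ)^n`, and the
factor `i = j` of the full product is `Γ(1) = 1`. -/
theorem meijerG_singleton_eq_genHypergeometric {j : Fin N}
    (hj : ∀ i ≠ j, ∀ m : ℕ, 1 - b i + b j ≠ -m) {ζ w : ℂ} (hw : exp w = -ζ) :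
    meijerG (p := 0) ![] ∅ b {j} w =
      exp (b j * w) / (∏ i, Gamma (1 + (b j - b i))) *
        genHypergeometric (![] : Fin 0 → ℂ)
          (fun i : {i : Fin N // i ≠ j} => 1 + (b j - b i)) ζ := by
  rw [meijerG_singleton, genHypergeometric, ← tsum_mul_left]
  refine tsum_congr fun n => ?_
  have hsub : ∀ f : Fin N → ℂ, ∏ i : {i : Fin N // i ≠ j}, f i = ∏ i ∈ {j}ᶜ, f i := fun f =>
    (Finset.prod_subtype _ (by simp) f).symm
  have h1 : ∏ i, Gamma (1 + (b j - b i)) = ∏ i ∈ {j}ᶜ, Gamma (1 + (b j - b i)) := by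
    rw [← Finset.prod_mul_prod_compl {j}]
    simp
  have h2 : ∏ i ∈ {j}ᶜ, (Gamma (1 - b i + (b j + n)))⁻¹ =
      (∏ i ∈ {j}ᶜ, (ascPochhammer ℂ n).eval (1 + (b j - b i)))⁻¹ *
        (∏ i ∈ {j}ᶜ, Gamma (1 + (b j - b i)))⁻¹ := by
    rw [← Finset.prod_inv_distrib, ← Finset.prod_inv_distrib, ← Finset.prod_mul_distrib]
    refine Finset.prod_congr rfl fun i hi => ?_
    rw [show 1 - b i + (b j + n) = 1 + (b j - b i) + n by ring,
      Gamma_add_natCast_eq_ascPochhammer, mul_inv]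
    intro m hm
    exact hj i (by simpa using hi) m (by linear_combination hm)
  rw [hsub (fun i => (ascPochhammer ℂ n).eval (1 + (b j - b i))), h1, singleCoeff, h2, add_mul,
    exp_add, exp_nat_mul, hw, neg_pow ζ]
  have h4 : ((-1 : ℂ) ^ n) * (-1) ^ n = 1 := by rw [← mul_pow]; simp
  simp only [Finset.univ_eq_empty, Finset.prod_empty, div_eq_mul_inv, one_mul]
  linear_combination ((n.factorial : ℂ)⁻¹ *
    (∏ i ∈ {j}ᶜ, (ascPochhammer ℂ n).eval (1 + (b j - b i)))⁻¹ *
    (∏ i ∈ {j}ᶜ, Gamma (1 + (b j - b i)))⁻¹ * exp (b j * w) * ζ ^ n) * h4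

end EulerMeijer

namespace EulerMeijer

open Metric Complex

/-! ### The blocks -/

variable {N : ℕ} {lam : Fin N → ℂ} {c : Composition N}

theorem mem_blockPrefix {i j : Fin N} : i ∈ blockPrefix c j ↔ c.index i = c.index j ∧ i ≤ j := by
  simp [blockPrefix]

theorem self_mem_blockPrefix (c : Composition N) (j : Fin N) : j ∈ blockPrefix c j :=
  mem_blockPrefix.2 ⟨rfl, le_rfl⟩

theorem blockPos_pos (c : Composition N) (j : Fin N) : 0 < blockPos c j :=
  Finset.card_pos.2 ⟨j, self_mem_blockPrefix c j⟩

theorem blockPos_lt_blockPos {i j : Fin N} (h : c.index i = c.index j) (hij : i < j) :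
    blockPos c i < blockPos c j := by
  refine Finset.card_lt_card (Finset.ssubset_iff_subset_ne.2 ⟨fun k hk => ?_, fun heq => ?_⟩)
  · rw [mem_blockPrefix] at hk ⊢
    exact ⟨hk.1.trans h, hk.2.trans hij.le⟩
  · have := self_mem_blockPrefix c j
    rw [← heq, mem_blockPrefix] at this
    exact absurd this.2 (not_le.2 hij)

theorem eq_of_blockPos_eq {i j : Fin N} (h : c.index i = c.index j)
    (hpos : blockPos c i = blockPos c j) : i = j := by
  rcases lt_trichotomy i j with hlt | heq | hlt
  · exact absurd hpos (blockPos_lt_blockPos h hlt).ne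
  · exact heq
  · exact absurd hpos (blockPos_lt_blockPos h.symm hlt).ne'

theorem blockPrefix_eq_singleton {j : Fin N} (h : blockPos c j = 1) : blockPrefix c j = {j} := by
  obtain ⟨i, hi⟩ := Finset.card_eq_one.1 h
  have := self_mem_blockPrefix c j
  rw [hi, Finset.mem_singleton] at this
  rw [hi, this]

theorem exists_predecessor {j : Fin N} {m : ℕ} (h : blockPos c j = m + 2) :
    ∃ i, c.index i = c.index j ∧ blockPos c i = m + 1 ∧ j ∉ blockPrefix c i ∧
      blockPrefix c j = insert j (blockPrefix c i) := by
  have hne : ((blockPrefix c j).erase j).Nonempty := by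
    rw [← Finset.card_pos, Finset.card_erase_of_mem (self_mem_blockPrefix c j)]
    unfold blockPos at h
    omega
  obtain ⟨i, hi, hmax⟩ := Finset.exists_max_image _ id hne
  rw [Finset.mem_erase, mem_blockPrefix] at hi
  have hlt : i < j := lt_of_le_of_ne hi.2.2 hi.1
  have heq : blockPrefix c i = (blockPrefix c j).erase j := by
    ext k
    constructor
    · intro hk
      rw [mem_blockPrefix] at hk
      exact Finset.mem_erase.2 ⟨(hk.2.trans_lt hlt).ne,
        mem_blockPrefix.2 ⟨hk.1.trans hi.2.1, hk.2.trans hlt.le⟩⟩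
    · intro hk
      have h1 := hmax k hk
      rw [Finset.mem_erase, mem_blockPrefix] at hk
      exact mem_blockPrefix.2 ⟨hk.2.1.trans hi.2.1.symm, h1⟩
  refine ⟨i, hi.2.1, ?_, ?_, ?_⟩
  · unfold blockPos at h ⊢
    rw [heq, Finset.card_erase_of_mem (self_mem_blockPrefix c j), h]
    omega
  · rw [heq]
    simp
  · rw [heq, Finset.insert_erase (self_mem_blockPrefix c j)]

theorem IsCongruenceGrouping.exists_natCast (hN : 0 < N) (hc : IsCongruenceGrouping lam c)
    {i j : Fin N} (h : c.index i = c.index j) (hij : i ≤ j) :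
    ∃ n : ℕ, lam i / N = lam j / N + n := by
  obtain ⟨k, hk⟩ := (hc.1 i j).1 h
  have hre := hc.2 i j h hij
  have hN' : (0 : ℝ) < N := by exact_mod_cast hN
  have h1 : ((lam i - lam j) / N).re = (lam i - lam j).re / N := div_natCast_re _ _
  rw [hk, intCast_re, sub_re] at h1
  have h2 : (0 : ℝ) ≤ k := by
    rw [h1]
    exact div_nonneg (by linarith) hN'.le
  obtain ⟨n, rfl⟩ := Int.eq_ofNat_of_zero_le (by exact_mod_cast h2 : 0 ≤ k)
  refine ⟨n, ?_⟩
  rw [sub_div] at hk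
  push_cast at hk
  linear_combination hk

/-- By the ordering within a block, `j` has the smallest real part in its prefix, so `lam j / N` can
serve as base point. -/
theorem IsCongruenceGrouping.polesIn (hN : 0 < N) (hc : IsCongruenceGrouping lam c) (j : Fin N) :
    PolesIn (fun i => lam i / N) (blockPrefix c j) (lam j / N) := fun _ hi =>
  hc.exists_natCast hN (mem_blockPrefix.1 hi).1 (mem_blockPrefix.1 hi).2

/-- The first index has the largest real part: the number is a positive integer within the block and
no integer outside it. -/
theorem IsCongruenceGrouping.ne_neg_natCast (hN : 0 < N) (hc : IsCongruenceGrouping lam c)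
    {j : Fin N} (hj : blockPos c j = 1) :
    ∀ i ≠ j, ∀ m : ℕ, 1 - lam i / N + lam j / N ≠ -(m : ℂ) := by
  intro i hi m hm
  have hidx : c.index i = c.index j := (hc.1 i j).2 ⟨m + 1, by
    rw [sub_div]; push_cast; linear_combination -hm⟩
  have hji : j ≤ i := by
    by_contra! hlt
    have : i ∈ blockPrefix c j := mem_blockPrefix.2 ⟨hidx, hlt.le⟩
    rw [blockPrefix_eq_singleton hj, Finset.mem_singleton] at this
    exact hi this
  obtain ⟨n, hn⟩ := hc.exists_natCast hN hidx.symm hji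
  rw [hn] at hm
  have h1 : ((1 + n + m : ℕ) : ℂ) = 0 := by push_cast; linear_combination hm
  have h2 : 1 + n + m = 0 := by exact_mod_cast h1
  omega

theorem IsCongruenceGrouping.exp_eq_exp_iff (hc : IsCongruenceGrouping lam c) {i j : Fin N} :
    exp (lam i / N * (2 * Real.pi * I)) = exp (lam j / N * (2 * Real.pi * I)) ↔
      c.index i = c.index j := by
  have hpi : (2 * Real.pi * I : ℂ) ≠ 0 := two_pi_I_ne_zero
  rw [hc.1, Complex.exp_eq_exp_iff_exists_int]
  refine exists_congr fun k => ⟨fun h => mul_right_cancel₀ hpi ?_, fun h => ?_⟩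
  · rw [sub_div]
    linear_combination h
  · rw [sub_div] at h
    linear_combination (2 * Real.pi * I : ℂ) * h

/-- Each application of the monodromy operator removes the last front parameter. The base point `β`
is arbitrary because the induction passes to the predecessor while keeping the base point of the
original index. -/
theorem IsCongruenceGrouping.genEigenvector (hN : 0 < N) (hc : IsCongruenceGrouping lam c) (m : ℕ) :
    ∀ (j : Fin N) (β : ℂ), blockPos c j = m + 1 →
      PolesIn (fun i => lam i / N) (blockPrefix c j) β →
      ((shift (2 * Real.pi * I) - algebraMap ℂ _ (exp (lam j / N * (2 * Real.pi * I)))) ^ (m + 1))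
        (poleSum (fun i => lam i / N) (blockPrefix c j) β) = 0 ∧
      ((shift (2 * Real.pi * I) - algebraMap ℂ _ (exp (lam j / N * (2 * Real.pi * I)))) ^ m)
        (poleSum (fun i => lam i / N) (blockPrefix c j) β) ≠ 0 := by
  induction m with
  | zero =>
    intro j β hj hβ
    rw [blockPrefix_eq_singleton hj] at hβ ⊢
    refine ⟨?_, ?_⟩
    · have h := PolesIn.monodromy_poleSum hN (Finset.notMem_empty j) hβ
      rw [poleSum_empty, map_zero, smul_zero] at h
      simpa using h
    · intro h0
      refine poleSum_singleton_ne_zero (b := fun i => lam i / N) hN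
        (hc.ne_neg_natCast hN hj) (funext fun w => ?_)
      -- The sums with base points `β` and `lam j / N` both compute the same `meijerG`.
      have h1 := hβ.meijerG_eq w
      rw [(polesIn_singleton _ j).meijerG_eq w] at h1
      have h2 := mul_left_cancel₀ (neg_ne_zero.2 (inv_ne_zero two_pi_I_ne_zero)) h1
      rw [h2]
      exact congrFun h0 w
  | succ m ih =>
    intro j β hj hβ
    obtain ⟨i, hidx, hpos, hnot, heq⟩ := exists_predecessor hj
    rw [heq] at hβ ⊢
    obtain ⟨ih1, ih2⟩ := ih i β hpos (hβ.mono (Finset.subset_insert _ _))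
    rw [hc.exp_eq_exp_iff.2 hidx] at ih1 ih2
    have h := PolesIn.monodromy_poleSum hN hnot hβ
    have hC : -(2 * Real.pi * I) * exp (Real.pi * I * (lam j / N)) ≠ 0 :=
      mul_ne_zero (neg_ne_zero.2 two_pi_I_ne_zero) (exp_ne_zero _)
    refine ⟨?_, ?_⟩
    · rw [pow_succ, Module.End.mul_apply, h, map_smul, pow_shift_sub_apply_shift, ih1, map_zero,
        smul_zero]
    · rw [pow_succ, Module.End.mul_apply, h, map_smul, pow_shift_sub_apply_shift]
      refine smul_ne_zero hC fun h0 => ih2 (shift_injective _ (h0.trans (map_zero _).symm))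

/-- The constants `κ j` absorb the different choices of logarithm. -/
theorem IsCongruenceGrouping.linearIndependent_shift (hN : 0 < N) (hc : IsCongruenceGrouping lam c)
    (κ : Fin N → ℂ) : LinearIndependent ℂ fun j => shift (κ j) (blockG lam c j) := by
  have hG : ∀ j, blockG lam c j = (-(2 * (Real.pi : ℂ) * I)⁻¹) •
      poleSum (fun i => lam i / N) (blockPrefix c j) (lam j / N) := fun j => funext fun w =>
    (hc.polesIn hN j).meijerG_eq w
  have hC : -(2 * (Real.pi : ℂ) * I)⁻¹ ≠ 0 := neg_ne_zero.2 (inv_ne_zero two_pi_I_ne_zero)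
  have hpos : ∀ j, blockPos c j = blockPos c j - 1 + 1 := fun j =>
    (Nat.sub_add_cancel (blockPos_pos c j)).symm
  refine linearIndependent_of_genEigenvectors (shift (2 * Real.pi * I))
    (fun j => exp (lam j / N * (2 * Real.pi * I))) (fun j => blockPos c j - 1) _ ?_ ?_ ?_
  · intro i j h1 h2
    refine eq_of_blockPos_eq (hc.exp_eq_exp_iff.1 h1) ?_
    rw [hpos i, hpos j, h2]
  · intro j
    rw [pow_shift_sub_apply_shift, hG, map_smul,
      (hc.genEigenvector hN _ j _ (hpos j) (hc.polesIn hN j)).1, smul_zero, map_zero]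
  · intro j h0
    rw [pow_shift_sub_apply_shift] at h0
    have h1 := shift_injective _ (h0.trans (map_zero _).symm)
    rw [hG, map_smul] at h1
    exact smul_ne_zero hC (hc.genEigenvector hN _ j _ (hpos j) (hc.polesIn hN j)).2 h1

theorem IsCongruenceGrouping.differentiable_blockG (hN : 0 < N) (hc : IsCongruenceGrouping lam c)
    (j : Fin N) : Differentiable ℂ (blockG lam c j) := by
  have hG : blockG lam c j = fun w => -(2 * (Real.pi : ℂ) * I)⁻¹ *
      poleSum (fun i => lam i / N) (blockPrefix c j) (lam j / N) w := funext fun w =>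
    (hc.polesIn hN j).meijerG_eq w
  rw [hG]
  exact ((hc.polesIn hN j).differentiable_poleSum hN).const_mul _

theorem derivList_const_mul {f : ℂ → ℂ} (hf : Differentiable ℂ f) (a : ℂ) (l : List ℂ) :
    derivList l (fun w => a * f w) = fun w => a * derivList l f w := by
  induction l with
  | nil => rfl
  | cons d l ih =>
    funext w
    rw [derivList_cons, ih, deriv_const_mul _ (differentiable_derivList hf l w), derivList_cons]
    ring

theorem IsCongruenceGrouping.derivList_blockG (hN : 0 < N) (hc : IsCongruenceGrouping lam c)
    (j : Fin N) (w : ℂ) :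
    derivList (List.ofFn fun i => lam i / N) (blockG lam c j) w =
      (-1) ^ blockPos c j * exp w * blockG lam c j w := by
  have hβ := hc.polesIn hN j
  have hG : blockG lam c j = fun w => -(2 * (Real.pi : ℂ) * I)⁻¹ *
      poleSum (fun i => lam i / N) (blockPrefix c j) (lam j / N) w := funext fun w =>
    hβ.meijerG_eq w
  rw [hG, derivList_const_mul (hβ.differentiable_poleSum hN)]
  simp only [hβ.derivList_poleSum hN, blockPos]
  ring

/-! ### Substituting branches of the logarithm -/

theorem mul_deriv_eq_of_exp_eq {U : Set ℂ} (hU : IsOpen U) {L : ℂ → ℂ} {A : ℂ} {k : ℕ}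
    (hL : DifferentiableOn ℂ L U) (hexp : ∀ z ∈ U, exp (L z) = A * z ^ k) :
    ∀ z ∈ U, z * deriv L z = k := by
  intro z hz
  have h1 : HasDerivAt (fun z => exp (L z)) (exp (L z) * deriv L z) z :=
    (hL.differentiableAt (hU.mem_nhds hz)).hasDerivAt.cexp
  have h2 : HasDerivAt (fun z : ℂ => A * z ^ k) (A * (k * z ^ (k - 1))) z :=
    (hasDerivAt_pow k z).const_mul A
  have h3 := h1.unique (h2.congr_of_eventuallyEq
    (Filter.eventuallyEq_of_mem (hU.mem_nhds hz) hexp))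
  refine mul_left_cancel₀ (exp_ne_zero (L z)) ?_
  rcases k with _ | k
  · simp only [Nat.cast_zero, zero_mul, mul_zero] at h3 ⊢
    rw [mul_left_comm, h3, mul_zero]
  · rw [mul_left_comm, h3, hexp z hz, Nat.add_sub_cancel, pow_succ]
    ring

/-- The common core of the two equations: `exp (L j z) = (-1) ^ ℓ_j A z ^ k`. -/
theorem IsCongruenceGrouping.fundamentalSystem (hN : 0 < N) (hc : IsCongruenceGrouping lam c)
    {U : Set ℂ} (hU : IsPuncturedDomain U) {A : ℂ} {k : ℕ} (hk : k ≠ 0) {L : Fin N → ℂ → ℂ}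
    (hL : ∀ j, IsLogBranch U (fun z => (-1) ^ blockPos c j * (A * z ^ k)) (L j)) :
    IsFundamentalSystem U
      (fun f => DifferentiableOn ℂ f U ∧
        ∀ z ∈ U, eulerProd (fun i => k * (lam i / N)) f z = (k : ℂ) ^ N * (A * z ^ k) * f z)
      (fun j z => blockG lam c j (L j z)) := by
  obtain ⟨hUo, hUc, h0⟩ := id hU
  have hLk : ∀ j, ∀ z ∈ U, z * deriv (L j) z = k := fun j =>
    mul_deriv_eq_of_exp_eq (A := (-1) ^ blockPos c j * A) hUo (hL j).1 fun z hz => by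
      rw [(hL j).2 z hz, mul_assoc]
  have hdiff : ∀ j, DifferentiableOn ℂ (fun z => blockG lam c j (L j z)) U := fun j =>
    (hc.differentiable_blockG hN j).comp_differentiableOn (hL j).1
  have hsol : ∀ j, ∀ z ∈ U,
      eulerProd (fun i => k * (lam i / N)) (fun z => blockG lam c j (L j z)) z =
      (k : ℂ) ^ N * (A * z ^ k) * blockG lam c j (L j z) := by
    intro j z hz
    have h := eulerList_comp hUo (hL j).1 (hLk j) (hc.differentiable_blockG hN j)
      (List.ofFn fun i => lam i / N) z hz
    rw [List.map_ofFn, List.length_ofFn, hc.derivList_blockG hN, (hL j).2 z hz] at h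
    refine h.trans ?_
    -- The sign from the equation in `w` cancels the sign in the argument of the logarithm.
    have h1 : ((-1 : ℂ) ^ blockPos c j) * (-1) ^ blockPos c j = 1 := by rw [← mul_pow]; simp
    linear_combination (k : ℂ) ^ N * (A * z ^ k) * blockG lam c j (L j z) * h1
  have hli : LinearIndependent ℂ (fun j (z : U) => blockG lam c j (L j z)) := by
    obtain ⟨z₀, hz₀⟩ := hUc.nonempty
    let j₀ : Fin N := ⟨0, hN⟩
    have hne : ∀ z ∈ U, z ≠ 0 := fun z hz h => h0 (h ▸ hz)
    -- All branches have derivative `k / z`, so on the connected set `U` they differ by constants.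
    have hconst : ∀ j, ∀ z ∈ U, L j z = L j₀ z + (L j z₀ - L j₀ z₀) := by
      intro j z hz
      have hd : ∀ x ∈ U, deriv (fun z => L j z - L j₀ z) x = 0 := by
        intro x hx
        rw [deriv_fun_sub ((hL j).1.differentiableAt (hUo.mem_nhds hx))
          ((hL j₀).1.differentiableAt (hUo.mem_nhds hx))]
        refine mul_left_cancel₀ (hne x hx) ?_
        rw [mul_sub, hLk j x hx, hLk j₀ x hx, sub_self, mul_zero]
      have := hUo.is_const_of_deriv_eq_zero hUc.isPreconnected ((hL j).1.sub (hL j₀).1) hd hz hz₀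
      simp only [Pi.sub_apply] at this
      linear_combination this
    rw [Fintype.linearIndependent_iff]
    intro a ha
    have hind := hc.linearIndependent_shift hN fun j => L j z₀ - L j₀ z₀
    refine Fintype.linearIndependent_iff.1 hind a ?_
    set H : ℂ → ℂ := ∑ j, a j • shift (L j z₀ - L j₀ z₀) (blockG lam c j) with hH
    have hHapply : ∀ w, H w = ∑ j, a j * blockG lam c j (w + (L j z₀ - L j₀ z₀)) := fun w => by
      simp [hH]
    have hHd : Differentiable ℂ H := by
      rw [funext hHapply]
      exact Differentiable.fun_sum fun j _ => ((hc.differentiable_blockG hN j).comp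
        (differentiable_id.add_const _)).const_mul _
    have hcomp : ∀ z ∈ U, H (L j₀ z) = 0 := by
      intro z hz
      have := congrFun ha ⟨z, hz⟩
      simp only [Finset.sum_apply, Pi.smul_apply, smul_eq_mul, Pi.zero_apply] at this
      rw [hHapply, ← this]
      exact Finset.sum_congr rfl fun j _ => by rw [← hconst j z hz]
    have hderiv : deriv (L j₀) z₀ ≠ 0 := by
      intro h
      have := hLk j₀ z₀ hz₀
      rw [h, mul_zero] at this
      exact hk (by exact_mod_cast this.symm)
    have hstrict : HasStrictDerivAt (L j₀) (deriv (L j₀) z₀) z₀ :=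
      ((hL j₀).1.analyticAt (hUo.mem_nhds hz₀)).hasStrictDerivAt
    -- `L j₀` maps neighbourhoods of `z₀` onto neighbourhoods of its value, so `H` vanishes near a
    -- point, and then everywhere by the identity theorem.
    have hev : H =ᶠ[𝓝 (L j₀ z₀)] 0 := by
      rw [← hstrict.map_nhds_eq hderiv]
      exact Filter.eventually_map.2 (Filter.eventually_of_mem (hUo.mem_nhds hz₀) hcomp)
    have hHan : AnalyticOnNhd ℂ H Set.univ := hHd.differentiableOn.analyticOnNhd isOpen_univ
    funext w
    exact hHan.eqOn_zero_of_preconnected_of_eventuallyEq_zero isPreconnected_univ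
      (Set.mem_univ _) hev (Set.mem_univ w)
  refine ⟨fun j => ⟨hdiff j, hsol j⟩, hli, fun f hf => ?_⟩
  exact exists_eq_sum_of_solutions hN hU (q := fun z => (k : ℂ) ^ N * (A * z ^ k)) (by fun_prop)
    _ _ hdiff hsol hli hf.1 hf.2

theorem IsFundamentalSystem.congr {U : Set ℂ} {Sol Sol' : (ℂ → ℂ) → Prop} {u : Fin N → ℂ → ℂ}
    (h : IsFundamentalSystem U Sol u) (hSol : ∀ f, Sol f ↔ Sol' f) :
    IsFundamentalSystem U Sol' u :=
  ⟨fun j => (hSol _).1 (h.1 j), h.2.1, fun f hf => h.2.2 f ((hSol f).2 hf)⟩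

end EulerMeijer

/-! ### Specialization to the two differential equations. -/

theorem theorem4p3 {N : ℕ} (hN : 0 < N) (lam : Fin N → ℂ) (c : Composition N)
    (hc : EulerMeijer.IsCongruenceGrouping lam c) :
    -- the sums of residues that define the functions converge absolutely
    (∀ (j : Fin N) (w : ℂ),
      Summable fun ω : EulerMeijer.meijerPoles (fun i => lam i / N) (EulerMeijer.blockPrefix c j) =>
        ‖EulerMeijer.residue (EulerMeijer.meijerIntegrand (p := 0) ![] ∅ (fun i => lam i / N)
          (EulerMeijer.blockPrefix c j) w) ω‖) ∧
    -- the first function of each class, in terms of `_0F_{N-1}`; here `w = log (-ζ)`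
    (∀ j : Fin N, EulerMeijer.blockPos c j = 1 → ∀ ζ w : ℂ, Complex.exp w = -ζ →
      EulerMeijer.blockG lam c j w =
        Complex.exp (lam j / N * w) / (∏ i, Complex.Gamma (1 + (lam j - lam i) / N)) *
          EulerMeijer.genHypergeometric (![] : Fin 0 → ℂ)
            (fun i : {i : Fin N // i ≠ j} => 1 + (lam j - lam i) / N) ζ) ∧
    -- the fundamental system in the variable `ζ`; `L j` is a branch of `log ((-1)^ℓ ζ)`
    (∀ U : Set ℂ, EulerMeijer.IsPuncturedDomain U → ∀ L : Fin N → ℂ → ℂ,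
      (∀ j, EulerMeijer.IsLogBranch U (fun ζ => (-1) ^ EulerMeijer.blockPos c j * ζ) (L j)) →
      EulerMeijer.IsFundamentalSystem U
        (EulerMeijer.IsMeijerSolution (fun i => lam i / N) U)
        (fun j ζ => EulerMeijer.blockG lam c j (L j ζ))) ∧
    -- the fundamental system of the Euler eigenvalue equation, from `ζ = μ (z/N)^N`
    (∀ μ : ℂ, μ ≠ 0 → ∀ U : Set ℂ, EulerMeijer.IsPuncturedDomain U → ∀ L : Fin N → ℂ → ℂ,
      (∀ j, EulerMeijer.IsLogBranch U
        (fun z => (-1) ^ EulerMeijer.blockPos c j * (μ * (z / N) ^ N)) (L j)) →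
      EulerMeijer.IsFundamentalSystem U
        (EulerMeijer.IsEulerSolution lam μ U)
        (fun j z => EulerMeijer.blockG lam c j (L j z))) := by
  have hN' : (N : ℂ) ≠ 0 := by exact_mod_cast hN.ne'
  refine ⟨fun j w => (hc.polesIn hN j).summable_norm_residue hN w, ?_, ?_, ?_⟩
  · intro j hj ζ w hw
    have h := EulerMeijer.meijerG_singleton_eq_genHypergeometric (b := fun i => lam i / N)
      (hc.ne_neg_natCast hN hj) hw
    simp only [← sub_div] at h
    rw [EulerMeijer.blockG, EulerMeijer.blockPrefix_eq_singleton hj, h]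
  · intro U hU L hL
    refine (hc.fundamentalSystem hN hU (A := 1) (k := 1) one_ne_zero (L := L)
      (by simpa using hL)).congr fun f => and_congr_right fun _ => forall₂_congr fun z _ => ?_
    simp [sub_eq_zero]
  · intro μ hμ U hU L hL
    -- Here `A = μ / N^N` and `k = N`: the factor `k` rescales `lam i / N` to `lam i`, and `k^N`
    -- cancels the denominator of `A`.
    have hL' : ∀ j, EulerMeijer.IsLogBranch U
        (fun z => (-1) ^ EulerMeijer.blockPos c j * (μ / (N : ℂ) ^ N * z ^ N)) (L j) := fun j =>
      ⟨(hL j).1, fun z hz => by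
        simp only [(hL j).2 z hz, div_pow]
        ring⟩
    refine (hc.fundamentalSystem hN hU hN.ne' hL').congr fun f =>
      and_congr_right fun _ => forall₂_congr fun z hz => ?_
    have hz : z ≠ 0 := fun h => hU.2.2 (h ▸ hz)
    have hlam : (fun i => (N : ℂ) * (lam i / N)) = lam := by
      funext i
      field_simp
    rw [hlam, EulerMeijer.eulerTau, inv_mul_eq_iff_eq_mul₀ (pow_ne_zero N hz)]
    have hq : (N : ℂ) ^ N * (μ / (N : ℂ) ^ N * z ^ N) * f z = z ^ N * (μ * f z) := by
      field_simp
    rw [hq]
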